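/- Let $g\ge 2$ and $n\ge 2$ be integers and let $\mathcal H_g$ be the Siegel upper half-space of symmetric complex $g\times g$ matrices with positive definite imaginary part. For $\varepsilon,\delta\in\mathbb R^g$, $\tau\in\mathcal H_g$ and $z\in\mathbb C^g$ put $$\theta\!\left[{\varepsilon\atop\delta}\right]\!(\tau,z)=\sum_{m\in\mathbb Z^g}\exp\Big(2\pi i\big(\tfrac12(m+\varepsilon)^t\tau(m+\varepsilon)+(m+\varepsilon)^t(z+\delta)\big)\Big),\qquad \theta\!\left[{\varepsilon\atop\delta}\right]\!(\tau)=\theta\!\left[{\varepsilon\atop\delta}\right]\!(\tau,0).$$ Let $\Phi_{4n}(\tau)$ be the point of the Grassmannian of $g$-planes in $\mathbb C^{(4n)^g}$ given by the row space of the $g\times(4n)^g$ matrix whose columns are the gradients $\mathrm{grad}_{z=0}\,\theta\!\left[{a\atop 0}\right]\!(4n\tau,z)$, for all $a\in(\frac1{4n}\mathbb Z/\mathbb Z)^g$. Fix $\sigma,\delta\in(\frac12\mathbb Z/\mathbb Z)^g$ and $a,b\in(\frac1{2n}\mathbb Z/\mathbb Z)^g$ with $a+b-\frac{\delta}{n}\in(\frac1n\mathbb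 Z/\mathbb Z)^g$ (for one, equivalently every, choice of representatives in $\mathbb R^g$). Then $\Phi_{4n}(\tau)$ uniquely determines the projective point $$\left(\theta\!\left[{a\atop\gamma+\sigma}\right]\!(n\tau)\;\theta\!\left[{b\atop\gamma}\right]\!(n\tau)\right)_{\gamma\in(\frac12\mathbb Z/\mathbb Z)^g}.$$ That is, if $\tau,\tau'\in\mathcal H_g$ satisfy $\Phi_{4n}(\tau)=\Phi_{4n}(\tau')$, then there is a constant $t\in\mathbb C\setminus\{0\}$ such that for all $\gamma$ $$\theta\!\left[{a\atop\gamma+\sigma}\right]\!(n\tau)\;\theta\!\left[{b\atop\gamma}\right]\!(n\tau)=t\;\theta\!\left[{a\atop\gamma+\sigma}\right]\!(n\tau')\;\theta\!\left[{b\atop\gamma}\right]\!(n\tau').$$ (This vector may be zero; in that case the assertion is that it vanishes at $\tau$ if and only if it vanishes at $\tau'$.) Here representatives in $\mathbb R^g$ of $\sigma$ and the $\gamma$ are used, the same on both sides; the assertion does not depend on their choice. -/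

import Mathlib

/-- The Siegel upper half-space: symmetric complex `g × g` matrices with positive definite
imaginary part. -/
def SiegelUpperHalfSpace (g : ℕ) : Type :=
  {τ : Matrix (Fin g) (Fin g) ℂ // τ.IsSymm ∧ (τ.map Complex.im).PosDef}

/-- `e(t) = exp(2πit)`. -/
noncomputable def expTwoPiI (t : ℂ) : ℂ :=
  Complex.exp (2 * Real.pi * Complex.I * t)

open scoped Matrix in
/-- The theta function with characteristics `ε, δ ∈ ℝ^g`,
`θ[ε, δ](τ, z) = ∑_{m ∈ ℤ^g} e(½ (m+ε)ᵗ τ (m+ε) + (m+ε)ᵗ (z+δ))`. -/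
noncomputable def riemannTheta {g : ℕ} (ε δ : Fin g → ℝ) (τ : Matrix (Fin g) (Fin g) ℂ)
    (z : Fin g → ℂ) : ℂ :=
  ∑' m : Fin g → ℤ,
    expTwoPiI (1 / 2 * ((fun i => (m i : ℂ) + (ε i : ℂ)) ⬝ᵥ
        (τ *ᵥ (fun i => (m i : ℂ) + (ε i : ℂ)))) +
      (fun i => (m i : ℂ) + (ε i : ℂ)) ⬝ᵥ (fun i => z i + (δ i : ℂ)))

/-- `v ∈ (1/m) ℤ^g`. The elements of `((1/m)ℤ/ℤ)^g` are represented by such vectors, taken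
modulo `ℤ^g`. -/
def IsCharOfOrder {g : ℕ} (m : ℕ) (v : Fin g → ℝ) : Prop :=
  ∀ i, ∃ k : ℤ, v i = (k : ℝ) / (m : ℝ)

/-- The partial derivative `∂/∂z_i` at `z = 0` of `θ[a, 0](4nτ, z)`, where
`a = (k_1/4n, …, k_g/4n)`. As `k` runs through `{0, …, 4n-1}^g`, `a` runs through
representatives of all classes of `((1/4n)ℤ/ℤ)^g`, and the theta function depends only on the
class of `a`. For fixed `k` these are the entries of the gradient. -/
noncomputable def thetaGradient {g : ℕ} (n : ℕ) (τ : SiegelUpperHalfSpace g)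
    (i : Fin g) (k : Fin g → Fin (4 * n)) : ℂ :=
  lineDeriv ℂ
    (fun z : Fin g → ℂ =>
      riemannTheta (fun j => ((k j : ℕ) : ℝ) / ((4 * n : ℕ) : ℝ)) 0 ((4 * n : ℂ) • τ.1) z)
    0 (Pi.single i 1)

/-- The point `Φ_{4n}(τ)` of the Grassmannian of `g`-planes in `ℂ^{(4n)^g}` given by the
`g × (4n)^g` matrix of the gradients of all theta functions of order `4n`: it is the subspace
spanned by the `g` rows of this matrix. -/
noncomputable def gradientThetaMap {g : ℕ} (n : ℕ) (τ : SiegelUpperHalfSpace g) :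
    Submodule ℂ ((Fin g → Fin (4 * n)) → ℂ) :=
  Submodule.span ℂ (Set.range (thetaGradient n τ))

open scoped Matrix
open Filter Topology
section Summability

theorem summable_pi_prod {g : ℕ} {f : ℤ → ℝ} (hf : Summable f) (h0 : 0 ≤ f) :
    Summable fun m : Fin g → ℤ => ∏ i, f (m i) := by
  induction g with
  | zero => exact Summable.of_finite
  | succ k ih =>
    rw [← (Fin.consEquiv fun _ => ℤ).summable_iff]
    refine (hf.mul_of_nonneg ih h0 fun m => Finset.prod_nonneg fun i _ => h0 _).congr fun x => ?_
    simp [Fin.prod_univ_succ, Fin.consEquiv]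

theorem summable_exp_neg_sum_abs (g : ℕ) :
    Summable fun m : Fin g → ℤ => Real.exp (-∑ i, |(m i : ℝ)|) := by
  have h1 : Summable fun n : ℤ => Real.exp (-|(n : ℝ)|) := by
    refine Summable.of_nat_of_neg ?_ ?_ <;>
    · simp only [Int.cast_natCast, Int.cast_neg, abs_neg, Nat.abs_cast]
      exact Real.summable_exp_neg_nat
  refine (summable_pi_prod (g := g) h1 fun n => (Real.exp_pos _).le).congr fun m => ?_
  rw [← Real.exp_sum, Finset.sum_neg_distrib]

theorem exists_pow_mul_exp_le (d : ℕ) {a : ℝ} (ha : 0 < a) (b s : ℝ) :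
    ∃ C, 0 ≤ C ∧ ∀ t : ℝ, 0 ≤ t →
      t ^ d * Real.exp (-a * t ^ 2 + b * t) ≤ C * Real.exp (-s * t) := by
  refine ⟨d.factorial * Real.exp ((b + 1 + s) ^ 2 / (4 * a)), by positivity, fun t ht => ?_⟩
  have h1 : t ^ d ≤ d.factorial * Real.exp t := by
    have := Real.pow_div_factorial_le_exp t ht d
    rwa [div_le_iff₀' (by positivity)] at this
  have h2 : t + (-a * t ^ 2 + b * t) ≤ (b + 1 + s) ^ 2 / (4 * a) + -s * t := by
    have : 0 ≤ (2 * a * t - (b + 1 + s)) ^ 2 / (4 * a) := by positivity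
    have h3 : (2 * a * t - (b + 1 + s)) ^ 2 / (4 * a)
        = a * t ^ 2 - (b + 1 + s) * t + (b + 1 + s) ^ 2 / (4 * a) := by
      field_simp; ring
    linarith
  calc t ^ d * Real.exp (-a * t ^ 2 + b * t)
      ≤ (d.factorial * Real.exp t) * Real.exp (-a * t ^ 2 + b * t) := by gcongr
    _ = d.factorial * Real.exp (t + (-a * t ^ 2 + b * t)) := by rw [Real.exp_add t]; ring
    _ ≤ d.factorial * Real.exp ((b + 1 + s) ^ 2 / (4 * a) + -s * t) := by gcongr
    _ = _ := by rw [Real.exp_add]; ring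

theorem Matrix.PosDef.exists_mul_norm_sq_le {g : ℕ} {Y : Matrix (Fin g) (Fin g) ℝ}
    (hY : Y.PosDef) : ∃ μ : ℝ, 0 < μ ∧ ∀ x : Fin g → ℝ, μ * ‖x‖ ^ 2 ≤ x ⬝ᵥ Y *ᵥ x := by
  have hcont : Continuous fun x : Fin g → ℝ => x ⬝ᵥ Y *ᵥ x := by
    simp only [dotProduct, Matrix.mulVec]; fun_prop
  rcases (Metric.sphere (0 : Fin g → ℝ) 1).eq_empty_or_nonempty with he | hne
  · refine ⟨1, one_pos, fun x => ?_⟩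
    have hx : x = 0 := by
      by_contra hx
      have : (‖x‖⁻¹ • x) ∈ Metric.sphere (0 : Fin g → ℝ) 1 := by
        simp [norm_smul, norm_ne_zero_iff.2 hx]
      rw [he] at this; exact this
    simp [hx]
  · obtain ⟨x₀, hx₀, hmin⟩ := (isCompact_sphere (0 : Fin g → ℝ) 1).exists_isMinOn hne
      hcont.continuousOn
    have hx₀0 : x₀ ≠ 0 := by
      rintro rfl; simp at hx₀
    refine ⟨x₀ ⬝ᵥ Y *ᵥ x₀, by simpa using hY.dotProduct_mulVec_pos hx₀0, fun x => ?_⟩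
    by_cases hx : x = 0
    · simp [hx]
    have hn : ‖x‖ ≠ 0 := norm_ne_zero_iff.2 hx
    have hmem : (‖x‖⁻¹ • x) ∈ Metric.sphere (0 : Fin g → ℝ) 1 := by
      simp [norm_smul, hn]
    have := isMinOn_iff.1 hmin _ hmem
    rw [Matrix.mulVec_smul, smul_dotProduct, dotProduct_smul, smul_eq_mul, smul_eq_mul] at this
    calc _ ≤ (‖x‖⁻¹ * (‖x‖⁻¹ * (x ⬝ᵥ Y *ᵥ x))) * ‖x‖ ^ 2 := by gcongr
      _ = _ := by field_simp

end Summability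

section ThetaSeries

variable {g : ℕ}

/-- Membership of a matrix in the Siegel upper half-space. -/
def IsSiegel (τ : Matrix (Fin g) (Fin g) ℂ) : Prop :=
  τ.IsSymm ∧ (τ.map Complex.im).PosDef

theorem IsSiegel.natCast_smul {τ : Matrix (Fin g) (Fin g) ℂ} (hτ : IsSiegel τ) {a : ℕ}
    (ha : 0 < a) : IsSiegel ((a : ℂ) • τ) := by
  refine ⟨hτ.1.smul _, ?_⟩
  have : ((a : ℂ) • τ).map Complex.im = (a : ℝ) • τ.map Complex.im := by
    ext i j; simp
  rw [this]
  exact hτ.2.smul (by exact_mod_cast ha)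

theorem expTwoPiI_add (s t : ℂ) : expTwoPiI (s + t) = expTwoPiI s * expTwoPiI t := by
  rw [expTwoPiI, expTwoPiI, expTwoPiI, mul_add, Complex.exp_add]

theorem expTwoPiI_ne_zero (t : ℂ) : expTwoPiI t ≠ 0 := Complex.exp_ne_zero _

theorem expTwoPiI_intCast (k : ℤ) : expTwoPiI k = 1 := by
  rw [expTwoPiI, mul_comm]; exact Complex.exp_int_mul_two_pi_mul_I k

theorem norm_expTwoPiI (t : ℂ) : ‖expTwoPiI t‖ = Real.exp (-2 * Real.pi * t.im) := by
  rw [expTwoPiI, Complex.norm_exp]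
  simp

/-- The exponential `e(½ xᵗ τ x + xᵗ z)` whose sum over a shifted lattice is the theta series. -/
noncomputable def thetaExp (τ : Matrix (Fin g) (Fin g) ℂ) (x z : Fin g → ℂ) : ℂ :=
  expTwoPiI (1 / 2 * (x ⬝ᵥ τ *ᵥ x) + x ⬝ᵥ z)

/-- The vector `m + ε`. -/
def shiftVec (ε : Fin g → ℝ) (m : Fin g → ℤ) : Fin g → ℝ := fun i => (m i : ℝ) + ε i

/-- The complexification of a real vector. -/
def toComplexVec (x : Fin g → ℝ) : Fin g → ℂ := fun i => (x i : ℂ)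

/-- The theta series with characteristic `ε`, differentiated termwise in the directions `ws`. -/
noncomputable def thetaSeries (ws : List (Fin g → ℂ)) (ε : Fin g → ℝ)
    (τ : Matrix (Fin g) (Fin g) ℂ) (z : Fin g → ℂ) : ℂ :=
  ∑' m : Fin g → ℤ,
    (ws.map fun w => 2 * Real.pi * Complex.I * (toComplexVec (shiftVec ε m) ⬝ᵥ w)).prod *
      thetaExp τ (toComplexVec (shiftVec ε m)) z

theorem riemannTheta_eq_thetaSeries (ε δ : Fin g → ℝ) (τ : Matrix (Fin g) (Fin g) ℂ)
    (z : Fin g → ℂ) : riemannTheta ε δ τ z = thetaSeries [] ε τ (z + toComplexVec δ) := by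
  unfold riemannTheta thetaSeries thetaExp
  refine tsum_congr fun m => ?_
  have h : (fun i => (m i : ℂ) + (ε i : ℂ)) = toComplexVec (shiftVec ε m) := by
    ext i; simp [toComplexVec, shiftVec]
  rw [h, List.map_nil, List.prod_nil, one_mul]
  rfl

theorem norm_dotProduct_le_card_mul (x y : Fin g → ℂ) : ‖x ⬝ᵥ y‖ ≤ g * ‖x‖ * ‖y‖ := by
  calc ‖x ⬝ᵥ y‖ ≤ ∑ i, ‖x i * y i‖ := norm_sum_le _ _
    _ ≤ ∑ _i : Fin g, ‖x‖ * ‖y‖ := by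
        refine Finset.sum_le_sum fun i _ => ?_
        rw [norm_mul]
        exact mul_le_mul (norm_le_pi_norm x i) (norm_le_pi_norm y i) (norm_nonneg _)
          (norm_nonneg _)
    _ = _ := by simp; ring

theorem norm_toComplexVec (x : Fin g → ℝ) : ‖toComplexVec x‖ = ‖x‖ := by
  simp [Pi.norm_def, toComplexVec]

theorem im_quadratic_toComplexVec (τ : Matrix (Fin g) (Fin g) ℂ) (x : Fin g → ℝ) :
    (toComplexVec x ⬝ᵥ τ *ᵥ toComplexVec x).im = x ⬝ᵥ τ.map Complex.im *ᵥ x := by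
  simp [toComplexVec, dotProduct, Matrix.mulVec, Complex.im_sum, Complex.re_sum]

theorem norm_thetaExp_le {τ : Matrix (Fin g) (Fin g) ℂ} {μ : ℝ}
    (hμ : ∀ x : Fin g → ℝ, μ * ‖x‖ ^ 2 ≤ x ⬝ᵥ τ.map Complex.im *ᵥ x) (x : Fin g → ℝ)
    {z : Fin g → ℂ} {R : ℝ} (hz : ‖z‖ ≤ R) :
    ‖thetaExp τ (toComplexVec x) z‖ ≤
      Real.exp (-(Real.pi * μ) * ‖x‖ ^ 2 + 2 * Real.pi * g * R * ‖x‖) := by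
  rw [thetaExp, norm_expTwoPiI, Real.exp_le_exp]
  have h1 : (1 / 2 * (toComplexVec x ⬝ᵥ τ *ᵥ toComplexVec x) + toComplexVec x ⬝ᵥ z).im
      = 1 / 2 * (x ⬝ᵥ τ.map Complex.im *ᵥ x) + (toComplexVec x ⬝ᵥ z).im := by
    rw [← im_quadratic_toComplexVec]; simp
  have h2 : |(toComplexVec x ⬝ᵥ z).im| ≤ g * ‖x‖ * R := by
    refine (Complex.abs_im_le_norm _).trans ((norm_dotProduct_le_card_mul _ _).trans ?_)
    rw [norm_toComplexVec]; gcongr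
  have h3 := hμ x
  have h4 := (abs_le.1 h2).1
  rw [h1]
  nlinarith [Real.pi_pos, mul_le_mul_of_nonneg_left h3 Real.pi_pos.le,
    mul_le_mul_of_nonneg_left h4 Real.pi_pos.le]

theorem norm_prod_map_dotProduct_le (ws : List (Fin g → ℂ)) :
    ∃ C : ℝ, 0 ≤ C ∧ ∀ x : Fin g → ℂ,
      ‖(ws.map fun w => 2 * Real.pi * Complex.I * (x ⬝ᵥ w)).prod‖ ≤ C * ‖x‖ ^ ws.length := by
  induction ws with
  | nil => exact ⟨1, zero_le_one, fun x => by simp⟩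
  | cons w ws ih =>
    obtain ⟨C, hC, h⟩ := ih
    refine ⟨2 * Real.pi * (g * ‖w‖) * C, by positivity, fun x => ?_⟩
    rw [List.map_cons, List.prod_cons, norm_mul, List.length_cons, pow_succ]
    have : ‖2 * Real.pi * Complex.I * (x ⬝ᵥ w)‖ ≤ 2 * Real.pi * (g * ‖x‖ * ‖w‖) := by
      rw [norm_mul]
      have : ‖(2 * Real.pi * Complex.I : ℂ)‖ = 2 * Real.pi := by
        simp [abs_of_pos Real.pi_pos]
      rw [this]
      exact mul_le_mul_of_nonneg_left (norm_dotProduct_le_card_mul x w) (by positivity)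
    calc _ ≤ (2 * Real.pi * (g * ‖x‖ * ‖w‖)) * (C * ‖x‖ ^ ws.length) :=
          mul_le_mul this (h x) (norm_nonneg _) (by positivity)
      _ = _ := by ring

/-- A summable majorant for the termwise derivatives of the theta series on a ball. -/
theorem exists_summable_bound_thetaSeries {τ : Matrix (Fin g) (Fin g) ℂ} (hτ : IsSiegel τ)
    (ε : Fin g → ℝ) (ws : List (Fin g → ℂ)) (d : ℕ) (R : ℝ) :
    ∃ u : (Fin g → ℤ) → ℝ, Summable u ∧ ∀ m, ∀ z : Fin g → ℂ, ‖z‖ ≤ R →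
      ‖(ws.map fun w => 2 * Real.pi * Complex.I * (toComplexVec (shiftVec ε m) ⬝ᵥ w)).prod *
        thetaExp τ (toComplexVec (shiftVec ε m)) z‖ * ‖toComplexVec (shiftVec ε m)‖ ^ d ≤ u m := by
  obtain ⟨μ, hμ0, hμ⟩ := hτ.2.exists_mul_norm_sq_le
  obtain ⟨C, hC, hP⟩ := norm_prod_map_dotProduct_le ws
  obtain ⟨D, hD, hE⟩ := exists_pow_mul_exp_le (ws.length + d)
    (mul_pos Real.pi_pos hμ0) (2 * Real.pi * g * R) g
  refine ⟨fun m => C * (D * (Real.exp (g * ‖ε‖) * Real.exp (-∑ i, |(m i : ℝ)|))),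
    (((summable_exp_neg_sum_abs g).mul_left _).mul_left _).mul_left _, fun m z hz => ?_⟩
  set x := shiftVec ε m with hx
  have h1 := norm_thetaExp_le hμ x hz
  have h2 := hP (toComplexVec x)
  have h3 := hE ‖x‖ (norm_nonneg _)
  rw [norm_toComplexVec] at h2 ⊢
  have h4 : ∑ i, |(m i : ℝ)| ≤ g * ‖x‖ + g * ‖ε‖ := by
    calc ∑ i, |(m i : ℝ)| ≤ ∑ _i : Fin g, (‖x‖ + ‖ε‖) := by
          refine Finset.sum_le_sum fun i _ => ?_
          have e : (m i : ℝ) = x i - ε i := by simp [hx, shiftVec]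
          rw [e]
          refine (abs_sub _ _).trans (add_le_add ?_ ?_)
          · exact norm_le_pi_norm x i
          · exact norm_le_pi_norm ε i
      _ = _ := by simp
  calc _ ≤ (C * ‖x‖ ^ ws.length * Real.exp (-(Real.pi * μ) * ‖x‖ ^ 2 +
        2 * Real.pi * g * R * ‖x‖)) * ‖x‖ ^ d := by
        rw [norm_mul]
        gcongr
    _ = C * (‖x‖ ^ (ws.length + d) * Real.exp (-(Real.pi * μ) * ‖x‖ ^ 2 +
        2 * Real.pi * g * R * ‖x‖)) := by ring
    _ ≤ C * (D * Real.exp (-g * ‖x‖)) := by gcongr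
    _ ≤ _ := by
        simp only [← Real.exp_add]
        gcongr
        linarith

theorem summable_thetaSeries {τ : Matrix (Fin g) (Fin g) ℂ} (hτ : IsSiegel τ)
    (ε : Fin g → ℝ) (ws : List (Fin g → ℂ)) (z : Fin g → ℂ) :
    Summable fun m : Fin g → ℤ =>
      (ws.map fun w => 2 * Real.pi * Complex.I * (toComplexVec (shiftVec ε m) ⬝ᵥ w)).prod *
        thetaExp τ (toComplexVec (shiftVec ε m)) z := by
  obtain ⟨u, hu, h⟩ := exists_summable_bound_thetaSeries hτ ε ws 0 ‖z‖
  exact Summable.of_norm_bounded hu fun m => by simpa using h m z le_rfl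

/-- The dot product with a fixed vector as a continuous linear map. -/
noncomputable def dotCLM (x : Fin g → ℂ) : (Fin g → ℂ) →L[ℂ] ℂ :=
  ∑ i, x i • ContinuousLinearMap.proj i

@[simp]
theorem dotCLM_apply (x z : Fin g → ℂ) : dotCLM x z = x ⬝ᵥ z := by
  simp [dotCLM, dotProduct]

theorem norm_dotCLM_le (x : Fin g → ℂ) : ‖dotCLM x‖ ≤ g * ‖x‖ := by
  refine ContinuousLinearMap.opNorm_le_bound _ (by positivity) fun z => ?_
  rw [dotCLM_apply]
  exact norm_dotProduct_le_card_mul x z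

theorem hasFDerivAt_thetaExp (τ : Matrix (Fin g) (Fin g) ℂ) (x z : Fin g → ℂ) :
    HasFDerivAt (thetaExp τ x) ((2 * Real.pi * Complex.I * thetaExp τ x z) • dotCLM x) z := by
  have h1 : HasFDerivAt (fun z => 2 * Real.pi * Complex.I *
      (1 / 2 * (x ⬝ᵥ τ *ᵥ x) + dotCLM x z)) ((2 * Real.pi * Complex.I) • dotCLM x) z :=
    ((dotCLM x).hasFDerivAt.const_add _).const_mul _
  have h2 := h1.cexp
  rw [smul_smul] at h2
  simp only [dotCLM_apply] at h2
  rw [mul_comm (2 * Real.pi * Complex.I) (thetaExp τ x z)]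
  exact h2

/-- The derivative of a theta series is computed termwise. -/
theorem hasFDerivAt_thetaSeries {τ : Matrix (Fin g) (Fin g) ℂ} (hτ : IsSiegel τ)
    (ε : Fin g → ℝ) (ws : List (Fin g → ℂ)) (z : Fin g → ℂ) :
    ∃ L : (Fin g → ℂ) →L[ℂ] ℂ, HasFDerivAt (thetaSeries ws ε τ) L z ∧
      ∀ v, L v = thetaSeries (v :: ws) ε τ z := by
  obtain ⟨u, hu, h⟩ := exists_summable_bound_thetaSeries hτ ε ws 1 (‖z‖ + 1)
  set P : (Fin g → ℤ) → ℂ := fun m =>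
    (ws.map fun w => 2 * Real.pi * Complex.I * (toComplexVec (shiftVec ε m) ⬝ᵥ w)).prod with hP
  set f' : (Fin g → ℤ) → (Fin g → ℂ) → ((Fin g → ℂ) →L[ℂ] ℂ) := fun m z =>
    P m • ((2 * Real.pi * Complex.I * thetaExp τ (toComplexVec (shiftVec ε m)) z) •
      dotCLM (toComplexVec (shiftVec ε m))) with hf'
  have hbound : ∀ m, ∀ y ∈ Metric.ball (0 : Fin g → ℂ) (‖z‖ + 1),
      ‖f' m y‖ ≤ 2 * Real.pi * g * u m := by
    intro m y hy
    have := h m y (by simpa using (mem_ball_zero_iff.1 hy).le)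
    have hn : ‖(2 * Real.pi * Complex.I : ℂ)‖ = 2 * Real.pi := by
      simp [abs_of_pos Real.pi_pos]
    rw [pow_one, norm_mul] at this
    simp only [hf', norm_smul, norm_mul (2 * Real.pi * Complex.I : ℂ), hn]
    calc _ ≤ ‖P m‖ * (2 * Real.pi * ‖thetaExp τ (toComplexVec (shiftVec ε m)) y‖ *
          (g * ‖toComplexVec (shiftVec ε m)‖)) := by
          gcongr; exact norm_dotCLM_le _
      _ = 2 * Real.pi * g * (‖P m‖ * ‖thetaExp τ (toComplexVec (shiftVec ε m)) y‖ *
          ‖toComplexVec (shiftVec ε m)‖) := by ring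
      _ ≤ _ := by gcongr
  have hz : z ∈ Metric.ball (0 : Fin g → ℂ) (‖z‖ + 1) := by simp
  have hmain := hasFDerivAt_tsum_of_isPreconnected (𝕜 := ℂ)
    (f := fun m z => P m * thetaExp τ (toComplexVec (shiftVec ε m)) z) (f' := f')
    (hu.mul_left (2 * Real.pi * g)) Metric.isOpen_ball
    (convex_ball (0 : Fin g → ℂ) (‖z‖ + 1)).isPreconnected
    (fun m y _ => (hasFDerivAt_thetaExp τ _ y).const_mul (P m)) hbound hz
    (summable_thetaSeries hτ ε ws z) hz
  refine ⟨_, hmain, fun v => ?_⟩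
  have hs : Summable fun m => f' m z :=
    Summable.of_norm_bounded (hu.mul_left (2 * Real.pi * g)) fun m => hbound m z hz
  have htsum : (∑' m, f' m z) v = ∑' m, f' m z v :=
    (ContinuousLinearMap.apply ℂ ℂ v).map_tsum hs
  rw [htsum]
  unfold thetaSeries
  refine tsum_congr fun m => ?_
  simp only [hf', hP, smul_apply, dotCLM_apply, smul_eq_mul, List.map_cons,
    List.prod_cons]
  ring

theorem differentiable_thetaSeries {τ : Matrix (Fin g) (Fin g) ℂ} (hτ : IsSiegel τ)
    (ε : Fin g → ℝ) (ws : List (Fin g → ℂ)) : Differentiable ℂ (thetaSeries ws ε τ) := fun z =>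
  let ⟨_, hL, _⟩ := hasFDerivAt_thetaSeries hτ ε ws z
  hL.differentiableAt

theorem hasDerivAt_thetaSeries_line {τ : Matrix (Fin g) (Fin g) ℂ} (hτ : IsSiegel τ)
    (ε : Fin g → ℝ) (ws : List (Fin g → ℂ)) (z v : Fin g → ℂ) (t : ℂ) :
    HasDerivAt (fun t : ℂ => thetaSeries ws ε τ (z + t • v))
      (thetaSeries (v :: ws) ε τ (z + t • v)) t := by
  obtain ⟨L, hL, hv⟩ := hasFDerivAt_thetaSeries hτ ε ws (z + t • v)
  have h1 : HasDerivAt (fun t : ℂ => z + t • v) v t := by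
    simpa using ((hasDerivAt_id t).smul_const v).const_add z
  rw [← hv v]
  exact hL.comp_hasDerivAt t h1

theorem fderiv_thetaSeries {τ : Matrix (Fin g) (Fin g) ℂ} (hτ : IsSiegel τ)
    (ε : Fin g → ℝ) (ws : List (Fin g → ℂ)) (z v : Fin g → ℂ) :
    fderiv ℂ (thetaSeries ws ε τ) z v = thetaSeries (v :: ws) ε τ z := by
  obtain ⟨L, hL, hv⟩ := hasFDerivAt_thetaSeries hτ ε ws z
  rw [hL.fderiv, hv]

theorem thetaSeries_swap (v w : Fin g → ℂ) (ws : List (Fin g → ℂ)) (ε : Fin g → ℝ)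
    (τ : Matrix (Fin g) (Fin g) ℂ) (z : Fin g → ℂ) :
    thetaSeries (v :: w :: ws) ε τ z = thetaSeries (w :: v :: ws) ε τ z := by
  unfold thetaSeries
  refine tsum_congr fun m => ?_
  simp only [List.map_cons, List.prod_cons]
  ring

theorem thetaSeries_add_smul_cons {τ : Matrix (Fin g) (Fin g) ℂ} (hτ : IsSiegel τ) (s t : ℂ)
    (v w : Fin g → ℂ) (ws : List (Fin g → ℂ)) (ε : Fin g → ℝ) (z : Fin g → ℂ) :
    thetaSeries ((s • v + t • w) :: ws) ε τ z =
      s * thetaSeries (v :: ws) ε τ z + t * thetaSeries (w :: ws) ε τ z := by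
  simp only [← fderiv_thetaSeries hτ, map_add, map_smul, smul_eq_mul]

theorem thetaSeries_sum_cons {ι : Type*} (s : Finset ι) {τ : Matrix (Fin g) (Fin g) ℂ}
    (hτ : IsSiegel τ) (c : ι → ℂ) (v : ι → Fin g → ℂ) (ws : List (Fin g → ℂ)) (ε : Fin g → ℝ)
    (z : Fin g → ℂ) :
    thetaSeries ((∑ i ∈ s, c i • v i) :: ws) ε τ z =
      ∑ i ∈ s, c i * thetaSeries (v i :: ws) ε τ z := by
  simp only [← fderiv_thetaSeries hτ, map_sum, map_smul, smul_eq_mul]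

/-- The theta series depends on its characteristic only modulo integral vectors. -/
theorem thetaSeries_add_int (ws : List (Fin g → ℂ)) (ε : Fin g → ℝ) (p : Fin g → ℤ)
    (τ : Matrix (Fin g) (Fin g) ℂ) (z : Fin g → ℂ) :
    thetaSeries ws (fun i => ε i + p i) τ z = thetaSeries ws ε τ z := by
  unfold thetaSeries
  rw [← (Equiv.addRight p).tsum_eq fun m : Fin g → ℤ =>
    (ws.map fun w => 2 * Real.pi * Complex.I * (toComplexVec (shiftVec ε m) ⬝ᵥ w)).prod *
        thetaExp τ (toComplexVec (shiftVec ε m)) z]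
  refine tsum_congr fun m => ?_
  have : shiftVec (fun i => ε i + p i) m = shiftVec ε (Equiv.addRight p m) := by
    ext i; simp [shiftVec]; ring
  rw [this]

end ThetaSeries

section Addition

variable {g : ℕ}

theorem thetaExp_mul_thetaExp (a b : ℕ) (τ : Matrix (Fin g) (Fin g) ℂ) (x y p q : Fin g → ℂ) :
    thetaExp ((a : ℂ) • τ) (x + (b : ℂ) • y) p * thetaExp ((b : ℂ) • τ) (x - (a : ℂ) • y) q =
      thetaExp (((a + b : ℕ) : ℂ) • τ) x (p + q) *
        thetaExp (((a * b * (a + b) : ℕ) : ℂ) • τ) y ((b : ℂ) • p - (a : ℂ) • q) := by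
  simp only [thetaExp, ← expTwoPiI_add]
  congr 1
  simp only [Matrix.smul_mulVec, Matrix.mulVec_add, Matrix.mulVec_sub, Matrix.mulVec_smul,
    dotProduct_add, add_dotProduct, sub_dotProduct, dotProduct_sub, smul_dotProduct,
    dotProduct_smul, smul_eq_mul]
  push_cast
  ring

/-- The change of summation indices in the addition formula. -/
theorem bijective_additionIndex (a b : ℕ) (hab : 0 < a + b) :
    Function.Bijective fun x : (Fin g → Fin (a + b)) × ((Fin g → ℤ) × (Fin g → ℤ)) =>
      ((fun i => x.2.1 i + b * x.2.2 i + ((x.1 i : ℕ) : ℤ), fun i => x.2.1 i - a * x.2.2 i) :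
        (Fin g → ℤ) × (Fin g → ℤ)) := by
  have hN : (0 : ℤ) < (a + b : ℕ) := by exact_mod_cast hab
  constructor
  · rintro ⟨ν, r, w⟩ ⟨ν', r', w'⟩ h
    simp only [Prod.mk.injEq, funext_iff] at h
    obtain ⟨h1, h2⟩ := h
    have key : ∀ i, w i = w' i ∧ ((ν i : ℕ) : ℤ) = ((ν' i : ℕ) : ℤ) := by
      intro i
      have e : ((a + b : ℕ) : ℤ) * w i + ((ν i : ℕ) : ℤ) =
          ((a + b : ℕ) : ℤ) * w' i + ((ν' i : ℕ) : ℤ) := by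
        have := h1 i; have := h2 i; push_cast; linarith
      have l1 : ((ν i : ℕ) : ℤ) < (a + b : ℕ) := by exact_mod_cast (ν i).2
      have l2 : ((ν' i : ℕ) : ℤ) < (a + b : ℕ) := by exact_mod_cast (ν' i).2
      have d1 := Int.emod_emod_of_dvd ((ν i : ℕ) : ℤ) (dvd_refl ((a + b : ℕ) : ℤ))
      have e1 : ((ν i : ℕ) : ℤ) = ((ν' i : ℕ) : ℤ) := by
        have := congrArg (· % ((a + b : ℕ) : ℤ)) e
        simp only [Int.mul_add_emod_self_left] at this
        rwa [Int.emod_eq_of_lt (by positivity) l1, Int.emod_eq_of_lt (by positivity) l2] at this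
      refine ⟨?_, e1⟩
      rw [e1] at e
      exact mul_left_cancel₀ hN.ne' (add_right_cancel e)
    have hw : w = w' := funext fun i => (key i).1
    have hν : ν = ν' := funext fun i => Fin.ext (by exact_mod_cast (key i).2)
    have hr : r = r' := by
      funext i
      have := h2 i
      rw [hw] at this
      linarith
    rw [hw, hν, hr]
  · rintro ⟨m, k⟩
    have hlt : ∀ i, ((m i - k i) % ((a + b : ℕ) : ℤ)).toNat < a + b := fun i => by
      have := Int.emod_lt_of_pos (m i - k i) hN
      have := Int.emod_nonneg (m i - k i) hN.ne'
      omega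
    refine ⟨(fun i => ⟨_, hlt i⟩, fun i => k i + a * ((m i - k i) / ((a + b : ℕ) : ℤ)),
      fun i => (m i - k i) / ((a + b : ℕ) : ℤ)), ?_⟩
    simp only [Prod.mk.injEq]
    constructor
    · funext i
      rw [Int.toNat_of_nonneg (Int.emod_nonneg (m i - k i) hN.ne')]
      have := Int.emod_add_mul_ediv (m i - k i) ((a + b : ℕ) : ℤ)
      push_cast at this ⊢
      linarith
    · funext i
      ring

/-- The addition formula: a product of theta functions of levels `a` and `b` is a finite
combination of theta functions of level `a + b`. -/
theorem thetaSeries_mul_thetaSeries {a b : ℕ} (ha : 0 < a) (hb : 0 < b)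
    {τ : Matrix (Fin g) (Fin g) ℂ} (hτ : IsSiegel τ) (α β : Fin g → ℝ) (p q : Fin g → ℂ) :
    thetaSeries [] α ((a : ℂ) • τ) p * thetaSeries [] β ((b : ℂ) • τ) q =
      ∑ ν : Fin g → Fin (a + b),
        thetaSeries [] (fun i => (a * α i + b * β i + a * ((ν i : ℕ) : ℝ)) / ((a + b : ℕ) : ℝ))
            (((a + b : ℕ) : ℂ) • τ) (p + q) *
          thetaSeries [] (fun i => (((ν i : ℕ) : ℝ) + α i - β i) / ((a + b : ℕ) : ℝ))
            (((a * b * (a + b) : ℕ) : ℂ) • τ) ((b : ℂ) • p - (a : ℂ) • q) := by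
  have hab : 0 < a + b := by omega
  have hN : ((a + b : ℕ) : ℝ) ≠ 0 := by exact_mod_cast hab.ne'
  have key : ∀ x : (Fin g → Fin (a + b)) × ((Fin g → ℤ) × (Fin g → ℤ)),
      thetaExp ((a : ℂ) • τ) (toComplexVec (shiftVec α
        fun i => x.2.1 i + b * x.2.2 i + ((x.1 i : ℕ) : ℤ))) p *
      thetaExp ((b : ℂ) • τ) (toComplexVec (shiftVec β fun i => x.2.1 i - a * x.2.2 i)) q =
      thetaExp (((a + b : ℕ) : ℂ) • τ) (toComplexVec (shiftVec
        (fun i => (a * α i + b * β i + a * ((x.1 i : ℕ) : ℝ)) / ((a + b : ℕ) : ℝ)) x.2.1)) (p + q) *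
      thetaExp (((a * b * (a + b) : ℕ) : ℂ) • τ) (toComplexVec (shiftVec
        (fun i => (((x.1 i : ℕ) : ℝ) + α i - β i) / ((a + b : ℕ) : ℝ)) x.2.2))
          ((b : ℂ) • p - (a : ℂ) • q) := by
    rintro ⟨ν, r, w⟩
    rw [← thetaExp_mul_thetaExp]
    congr 2
    · ext i
      simp only [toComplexVec, shiftVec, Pi.add_apply, Pi.smul_apply, smul_eq_mul]
      norm_cast
      field_simp
      push_cast
      ring
    · ext i
      simp only [toComplexVec, shiftVec, Pi.sub_apply, Pi.smul_apply, smul_eq_mul]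
      norm_cast
      field_simp
      push_cast
      ring
  have sA := fun ε => summable_thetaSeries (hτ.natCast_smul ha) ε [] p
  have sB := fun ε => summable_thetaSeries (hτ.natCast_smul hb) ε [] q
  have sC := fun ε => summable_thetaSeries (hτ.natCast_smul hab) ε [] (p + q)
  have sD := fun ε => summable_thetaSeries
    (hτ.natCast_smul (show 0 < a * b * (a + b) by positivity)) ε [] ((b : ℂ) • p - (a : ℂ) • q)
  unfold thetaSeries
  simp only [List.map_nil, List.prod_nil, one_mul] at sA sB sC sD ⊢
  rw [tsum_mul_tsum_of_summable_norm (sA α).norm (sB β).norm]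
  have hsum := summable_mul_of_summable_norm (sA α).norm (sB β).norm
  set E := Equiv.ofBijective _ (bijective_additionIndex (g := g) a b hab) with hE
  rw [← E.tsum_eq]
  rw [← E.summable_iff] at hsum
  refine (Summable.tsum_prod hsum).trans ?_
  rw [tsum_fintype]
  refine Finset.sum_congr rfl fun ν _ => ?_
  rw [tsum_mul_tsum_of_summable_norm (sC _).norm (sD _).norm]
  exact tsum_congr fun x => key (ν, x)

end Addition

section QuasiPeriodicity

variable {g : ℕ}

/-- The complexification of an integral vector. -/
def intVec (p : Fin g → ℤ) : Fin g → ℂ := fun i => (p i : ℂ)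

theorem thetaSeries_add_intVec (ws : List (Fin g → ℂ)) (ε : Fin g → ℝ)
    (τ : Matrix (Fin g) (Fin g) ℂ) (z : Fin g → ℂ) (p : Fin g → ℤ) :
    thetaSeries ws ε τ (z + intVec p) =
      expTwoPiI (toComplexVec ε ⬝ᵥ intVec p) * thetaSeries ws ε τ z := by
  unfold thetaSeries
  rw [← tsum_mul_left]
  refine tsum_congr fun m => ?_
  have h1 : toComplexVec (shiftVec ε m) ⬝ᵥ intVec p =
      ((∑ i, m i * p i : ℤ) : ℂ) + toComplexVec ε ⬝ᵥ intVec p := by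
    simp only [toComplexVec, shiftVec, intVec, dotProduct, Complex.ofReal_add,
      Complex.ofReal_intCast, add_mul, Finset.sum_add_distrib, Int.cast_sum, Int.cast_mul]
  have h2 : thetaExp τ (toComplexVec (shiftVec ε m)) (z + intVec p) =
      expTwoPiI (toComplexVec ε ⬝ᵥ intVec p) * thetaExp τ (toComplexVec (shiftVec ε m)) z := by
    simp only [thetaExp]
    rw [dotProduct_add, h1, ← add_assoc, add_comm (((∑ i, m i * p i : ℤ) : ℂ)), ← add_assoc,
      expTwoPiI_add _ (((∑ i, m i * p i : ℤ) : ℂ)), expTwoPiI_intCast, mul_one, expTwoPiI_add,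
      mul_comm]
  rw [h2]
  ring

theorem thetaSeries_add_mulVec_intVec {τ : Matrix (Fin g) (Fin g) ℂ} (hτ : τ.IsSymm)
    (ε : Fin g → ℝ) (z : Fin g → ℂ) (p : Fin g → ℤ) :
    thetaSeries [] ε τ (z + τ *ᵥ intVec p) =
      expTwoPiI (-(1 / 2 * (intVec p ⬝ᵥ τ *ᵥ intVec p)) - intVec p ⬝ᵥ z) *
        thetaSeries [] ε τ z := by
  unfold thetaSeries
  rw [← (Equiv.addRight p).tsum_eq fun m : Fin g → ℤ => (List.map (fun w => 2 * Real.pi *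
    Complex.I * (toComplexVec (shiftVec ε m) ⬝ᵥ w)) []).prod *
        thetaExp τ (toComplexVec (shiftVec ε m)) z, ← tsum_mul_left]
  refine tsum_congr fun m => ?_
  have h1 : toComplexVec (shiftVec ε (Equiv.addRight p m)) =
      toComplexVec (shiftVec ε m) + intVec p := by
    ext i; simp [toComplexVec, shiftVec, intVec]; ring
  have h2 : intVec p ⬝ᵥ τ *ᵥ toComplexVec (shiftVec ε m) =
      toComplexVec (shiftVec ε m) ⬝ᵥ τ *ᵥ intVec p := by
    rw [Matrix.dotProduct_mulVec, ← Matrix.mulVec_transpose, hτ.eq, dotProduct_comm]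
  simp only [h1, List.map_nil, List.prod_nil, one_mul, thetaExp, ← expTwoPiI_add]
  congr 1
  simp only [Matrix.mulVec_add, dotProduct_add, add_dotProduct, h2]
  ring

theorem hasDerivAt_expTwoPiI_line (a b t : ℂ) :
    HasDerivAt (fun t : ℂ => expTwoPiI (a + t * b))
      (2 * Real.pi * Complex.I * b * expTwoPiI (a + t * b)) t := by
  have h : HasDerivAt (fun t : ℂ => 2 * Real.pi * Complex.I * (a + t * b))
      (2 * Real.pi * Complex.I * b) t := by
    simpa using (((hasDerivAt_id t).mul_const b).const_add a).const_mul (2 * Real.pi * Complex.I)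
  rw [mul_comm (2 * Real.pi * Complex.I * b)]
  exact h.cexp

theorem thetaSeries_singleton_add_mulVec_intVec {τ : Matrix (Fin g) (Fin g) ℂ} (hτ : IsSiegel τ)
    (ε : Fin g → ℝ) (z y : Fin g → ℂ) (p : Fin g → ℤ) :
    thetaSeries [y] ε τ (z + τ *ᵥ intVec p) =
      expTwoPiI (-(1 / 2 * (intVec p ⬝ᵥ τ *ᵥ intVec p)) - intVec p ⬝ᵥ z) *
        (thetaSeries [y] ε τ z - 2 * Real.pi * Complex.I * (intVec p ⬝ᵥ y) *
          thetaSeries [] ε τ z) := by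
  have h1 := hasDerivAt_thetaSeries_line hτ ε [] (z + τ *ᵥ intVec p) y 0
  have h2 := (hasDerivAt_expTwoPiI_line (-(1 / 2 * (intVec p ⬝ᵥ τ *ᵥ intVec p)) - intVec p ⬝ᵥ z)
    (-(intVec p ⬝ᵥ y)) 0).mul (hasDerivAt_thetaSeries_line hτ ε [] z y 0)
  have h3 : (fun t : ℂ => thetaSeries [] ε τ (z + τ *ᵥ intVec p + t • y)) =
      (fun t : ℂ => expTwoPiI (-(1 / 2 * (intVec p ⬝ᵥ τ *ᵥ intVec p)) - intVec p ⬝ᵥ z +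
        t * -(intVec p ⬝ᵥ y))) * fun t : ℂ => thetaSeries [] ε τ (z + t • y) := by
    ext t
    rw [add_right_comm, thetaSeries_add_mulVec_intVec hτ.1, Pi.mul_apply]
    congr 2
    rw [dotProduct_add, dotProduct_smul, smul_eq_mul]
    ring
  rw [h3] at h1
  have := h1.unique h2
  simp only [zero_smul, add_zero, zero_mul] at this
  rw [this]
  ring

end QuasiPeriodicity

section Nonvanishing

variable {g : ℕ}

/-- The normalised Haar measure on the unit circle, as used for Fourier series on tori. -/
noncomputable local instance : MeasureTheory.MeasureSpace UnitAddCircle := ⟨AddCircle.haarAddCircle⟩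

local instance :
    MeasureTheory.IsProbabilityMeasure (MeasureTheory.volume : MeasureTheory.Measure UnitAddCircle) :=
  inferInstanceAs (MeasureTheory.IsProbabilityMeasure AddCircle.haarAddCircle)

open UnitAddTorus in
theorem exists_thetaSeries_ne_zero {τ : Matrix (Fin g) (Fin g) ℂ} (hτ : IsSiegel τ)
    (ε : Fin g → ℝ) : ∃ z, thetaSeries [] ε τ z ≠ 0 := by
  by_contra! h0
  set a : (Fin g → ℤ) → ℂ := fun m => thetaExp τ (toComplexVec (shiftVec ε m)) 0 with ha
  have hs : Summable fun m => ‖a m‖ := by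
    simpa using (summable_thetaSeries hτ ε [] 0).norm
  have hsum : Summable fun m => a m • (mFourier m : C(UnitAddTorus (Fin g), ℂ)) :=
    .of_norm (by simpa only [norm_smul, mFourier_norm, mul_one] using hs)
  have hzero : ∑' m, a m • (mFourier m : C(UnitAddTorus (Fin g), ℂ)) = 0 := by
    ext x
    have hx : ∃ t : Fin g → ℝ, (fun i => (t i : UnitAddCircle)) = x :=
      ⟨fun i => Quotient.out (x i), funext fun i => Quotient.out_eq _⟩
    obtain ⟨t, rfl⟩ := hx
    have h1 := (ContinuousMap.evalCLM ℂ (fun i => (t i : UnitAddCircle))).map_tsum hsum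
    refine Eq.trans h1 ?_
    have h2 := h0 (toComplexVec t)
    have h3 : thetaSeries [] ε τ (toComplexVec t) = expTwoPiI (toComplexVec ε ⬝ᵥ toComplexVec t) *
        ∑' m, (ContinuousMap.evalCLM ℂ (fun i => (t i : UnitAddCircle)))
          (a m • (mFourier m : C(UnitAddTorus (Fin g), ℂ))) := by
      unfold thetaSeries
      rw [← tsum_mul_left]
      refine tsum_congr fun m => ?_
      have h4 : (ContinuousMap.evalCLM ℂ (fun i => (t i : UnitAddCircle)))
          (a m • (mFourier m : C(UnitAddTorus (Fin g), ℂ))) =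
          a m * expTwoPiI (∑ i, (m i : ℂ) * t i) := by
        simp only [map_smul, ContinuousMap.evalCLM_apply, smul_eq_mul, mFourier,
          ContinuousMap.coe_mk, fourier_coe_apply]
        rw [expTwoPiI, Finset.mul_sum, Complex.exp_sum]
        congr 1
        refine Finset.prod_congr rfl fun i _ => ?_
        congr 1
        push_cast
        ring
      rw [h4, ha]
      simp only [List.map_nil, List.prod_nil, one_mul, thetaExp, ← expTwoPiI_add]
      congr 1
      simp only [toComplexVec, shiftVec, dotProduct, Complex.ofReal_add,
        Complex.ofReal_intCast, add_mul, Finset.sum_add_distrib, Pi.zero_apply, mul_zero,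
        Finset.sum_const_zero]
      ring
    rw [h3] at h2
    exact (mul_eq_zero.1 h2).resolve_left (expTwoPiI_ne_zero _)
  have hL := (hsum.hasSum.mapL (ContinuousMap.toLp (E := ℂ) 2 MeasureTheory.volume ℂ))
  have hI := hL.mapL (innerSL ℂ (mFourierLp (d := Fin g) 2 0))
  rw [hzero, map_zero, map_zero] at hI
  have h5 : ∀ m, (innerSL ℂ (mFourierLp (d := Fin g) 2 0))
      ((ContinuousMap.toLp (E := ℂ) 2 MeasureTheory.volume ℂ) (a m • mFourier m)) =
      if m = 0 then a 0 else 0 := by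
    intro m
    have h6 := (orthonormal_iff_ite.1 (orthonormal_mFourier (d := Fin g))) 0 m
    rw [map_smul, map_smul, innerSL_apply_apply, smul_eq_mul]
    change a m * inner ℂ (mFourierLp 2 0) (mFourierLp 2 m) = _
    rw [h6]
    by_cases hm : m = 0
    · simp [hm]
    · simp [hm, Ne.symm hm]
  simp only [h5] at hI
  have h7 := hI.unique (hasSum_ite_eq 0 (a 0))
  exact expTwoPiI_ne_zero _ h7.symm

/-- The non-vanishing locus of an entire function in several variables is empty or dense. -/
theorem Differentiable.dense_ne_zero {F : (Fin g → ℂ) → ℂ} (hF : Differentiable ℂ F)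
    (h : ∃ z, F z ≠ 0) : Dense {z | F z ≠ 0} := by
  obtain ⟨z₁, hz₁⟩ := h
  rw [dense_iff_inter_open]
  intro U hU ⟨z₀, hz₀⟩
  by_contra hne
  have h0 : ∀ z ∈ U, F z = 0 := fun z hz => by
    by_contra hz'
    exact hne ⟨z, hz, hz'⟩
  have hline : Continuous fun t : ℂ => z₀ + t • (z₁ - z₀) := by fun_prop
  have hd : Differentiable ℂ fun t : ℂ => F (z₀ + t • (z₁ - z₀)) :=
    hF.comp (by fun_prop)
  have hev : (fun t : ℂ => F (z₀ + t • (z₁ - z₀))) =ᶠ[𝓝 0] 0 := by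
    have : ∀ᶠ t : ℂ in 𝓝 0, z₀ + t • (z₁ - z₀) ∈ U :=
      hline.continuousAt.eventually (hU.mem_nhds (by simpa using hz₀))
    exact this.mono fun t ht => h0 _ ht
  have := hd.differentiableOn.analyticOnNhd isOpen_univ |>.eqOn_zero_of_preconnected_of_eventuallyEq_zero
    isPreconnected_univ (Set.mem_univ 0) hev (Set.mem_univ 1)
  exact hz₁ (by simpa using this)

end Nonvanishing

section RegularLogDeriv

variable {g : ℕ}

/-- The logarithmic derivative of the theta function in direction `y` is holomorphic near `z₁`. -/
def RegularLogDerivAt (ε : Fin g → ℝ) (τ : Matrix (Fin g) (Fin g) ℂ) (y z₁ : Fin g → ℂ) : Prop :=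
  ∃ ψ : (Fin g → ℂ) → ℂ, ∀ᶠ z in 𝓝 z₁, DifferentiableAt ℂ ψ z ∧
    thetaSeries [y] ε τ z = thetaSeries [] ε τ z * ψ z

theorem IsSiegel.exists_real_coordinates {τ : Matrix (Fin g) (Fin g) ℂ} (hτ : IsSiegel τ)
    (z : Fin g → ℂ) :
    ∃ s t : Fin g → ℝ, z = toComplexVec s + τ *ᵥ toComplexVec t := by
  have hu : IsUnit (τ.map Complex.im).det := (Matrix.isUnit_iff_isUnit_det _).1 hτ.2.isUnit
  set t : Fin g → ℝ := (τ.map Complex.im)⁻¹ *ᵥ fun i => (z i).im with ht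
  have h1 : τ.map Complex.im *ᵥ t = fun i => (z i).im := by
    rw [ht, Matrix.mulVec_mulVec, Matrix.mul_nonsing_inv _ hu, Matrix.one_mulVec]
  refine ⟨fun i => (z i - (τ *ᵥ toComplexVec t) i).re, t, ?_⟩
  ext i
  have h2 : ((τ *ᵥ toComplexVec t) i).im = (z i).im := by
    rw [← congrFun h1 i]
    simp [Matrix.mulVec, dotProduct, toComplexVec, Complex.im_sum]
  apply Complex.ext
  · simp [toComplexVec]
  · simp [toComplexVec, h2]

theorem isBounded_range_of_periodic {τ : Matrix (Fin g) (Fin g) ℂ} (hτ : IsSiegel τ)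
    {F : (Fin g → ℂ) → ℂ} (hF : Continuous F) (h1 : ∀ z p, F (z + intVec p) = F z)
    (h2 : ∀ z p, F (z + τ *ᵥ intVec p) = F z) : Bornology.IsBounded (Set.range F) := by
  set φ : (Fin g → ℝ) × (Fin g → ℝ) → (Fin g → ℂ) := fun x =>
    toComplexVec x.1 + τ *ᵥ toComplexVec x.2 with hφ
  have hc : Continuous φ := by
    have hv : Continuous (toComplexVec (g := g)) :=
      continuous_pi fun i => Complex.continuous_ofReal.comp (continuous_apply i)
    exact (hv.comp continuous_fst).add
      (Continuous.matrix_mulVec continuous_const (hv.comp continuous_snd))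
  have hK : IsCompact (F '' (φ '' (Set.Icc 0 1 ×ˢ Set.Icc 0 1))) :=
    ((isCompact_Icc.prod isCompact_Icc).image hc).image hF
  refine hK.isBounded.subset ?_
  rintro _ ⟨z, rfl⟩
  obtain ⟨s, t, rfl⟩ := hτ.exists_real_coordinates z
  have hdecomp : ∀ s : Fin g → ℝ, toComplexVec s =
      toComplexVec (fun i => Int.fract (s i)) + intVec fun i => ⌊s i⌋ := by
    intro s
    ext i
    simp only [toComplexVec, intVec, Pi.add_apply]
    rw [← Complex.ofReal_intCast, ← Complex.ofReal_add, Int.fract_add_floor]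
  refine ⟨_, ⟨(fun i => Int.fract (s i), fun i => Int.fract (t i)), ?_, rfl⟩, ?_⟩
  · exact ⟨⟨fun i => Int.fract_nonneg _, fun i => (Int.fract_lt_one _).le⟩,
      ⟨fun i => Int.fract_nonneg _, fun i => (Int.fract_lt_one _).le⟩⟩
  · rw [hdecomp s, hdecomp t, Matrix.mulVec_add, ← add_assoc, h2, add_right_comm, h1]

/-- If the logarithmic derivative of a theta function in direction `y` has no poles, then `y = 0`. -/
theorem eq_zero_of_regularLogDerivAt {τ : Matrix (Fin g) (Fin g) ℂ} (hτ : IsSiegel τ)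
    (ε : Fin g → ℝ) {y : Fin g → ℂ} (h : ∀ z₁, RegularLogDerivAt ε τ y z₁) : y = 0 := by
  have hT : Continuous (thetaSeries [] ε τ) := (differentiable_thetaSeries hτ ε []).continuous
  have hdense : Dense {z | thetaSeries [] ε τ z ≠ 0} :=
    (differentiable_thetaSeries hτ ε []).dense_ne_zero (exists_thetaSeries_ne_zero hτ ε)
  choose ψ hψ using h
  have agree : ∀ z₁, (fun z => ψ z z) =ᶠ[𝓝 z₁] ψ z₁ := by
    intro z₁
    filter_upwards [(hψ z₁).eventually_nhds] with z hz
    by_contra hne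
    have c1 : ContinuousAt (ψ z₁) z := hz.self_of_nhds.1.continuousAt
    have c2 : ContinuousAt (ψ z) z := (hψ z).self_of_nhds.1.continuousAt
    have h3 : ∀ᶠ w in 𝓝 z, thetaSeries [] ε τ w = 0 := by
      filter_upwards [(c2.sub c1).eventually_ne (sub_ne_zero.2 hne), hz, hψ z] with w hw e1 e2
      have : thetaSeries [] ε τ w * (ψ z w - ψ z₁ w) = 0 := by
        rw [mul_sub, ← e1.2, ← e2.2, sub_self]
      exact (mul_eq_zero.1 this).resolve_right hw
    obtain ⟨w, hw1, hw2⟩ := hdense.inter_nhds_nonempty h3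
    exact hw1 hw2
  set Ψ : (Fin g → ℂ) → ℂ := fun z => ψ z z with hΨ
  have hdiff : Differentiable ℂ Ψ := fun z =>
    (hψ z).self_of_nhds.1.congr_of_eventuallyEq (agree z)
  have hmul : ∀ z, thetaSeries [y] ε τ z = thetaSeries [] ε τ z * Ψ z := fun z =>
    (hψ z).self_of_nhds.2
  have cancel : ∀ {G H : (Fin g → ℂ) → ℂ}, Continuous G → Continuous H →
      (∀ z, thetaSeries [] ε τ z * G z = thetaSeries [] ε τ z * H z) → G = H :=
    fun hG hH he => hG.ext_on hdense hH fun z hz => mul_left_cancel₀ hz (he z)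
  have hp1 : ∀ p z, Ψ (z + intVec p) = Ψ z := by
    intro p
    refine congrFun (cancel (hdiff.continuous.comp (continuous_add_const _)) hdiff.continuous
      fun z => ?_)
    have e := hmul (z + intVec p)
    rw [thetaSeries_add_intVec, thetaSeries_add_intVec, mul_assoc] at e
    rw [← hmul z]
    exact (mul_left_cancel₀ (expTwoPiI_ne_zero _) e).symm
  have hp2 : ∀ p z, Ψ (z + τ *ᵥ intVec p) = Ψ z - 2 * Real.pi * Complex.I * (intVec p ⬝ᵥ y) := by
    intro p
    refine congrFun (cancel (hdiff.continuous.comp (continuous_add_const _))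
      (hdiff.continuous.sub continuous_const) fun z => ?_)
    have e := hmul (z + τ *ᵥ intVec p)
    rw [thetaSeries_add_mulVec_intVec hτ.1, thetaSeries_singleton_add_mulVec_intVec hτ,
      mul_assoc (expTwoPiI _) (thetaSeries [] ε τ z)] at e
    rw [mul_sub, ← hmul z]
    refine (mul_left_cancel₀ (expTwoPiI_ne_zero _) e).symm.trans ?_
    ring
  have hadd : ∀ z w, Ψ (z + w) - Ψ z = Ψ (0 + w) - Ψ 0 := by
    intro z w
    have hd : Differentiable ℂ fun z => Ψ (z + w) - Ψ z :=
      (hdiff.comp (differentiable_id.add_const w)).sub hdiff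
    refine hd.apply_eq_apply_of_bounded (isBounded_range_of_periodic hτ hd.continuous ?_ ?_) z 0
    · intro z p
      rw [add_right_comm, hp1, hp1]
    · intro z p
      rw [add_right_comm, hp2, hp2]
      ring
  have hsmul : ∀ (t : ℂ) v, Ψ (t • v) - Ψ 0 = t * (Ψ v - Ψ 0) := by
    intro t v
    set f : ℂ → ℂ := fun t => Ψ (t • v) - Ψ 0 with hf
    have hfd : Differentiable ℂ f := (hdiff.comp (by fun_prop)).sub_const _
    have hfa : ∀ s t, f (s + t) = f s + f t := fun s t => by
      have := hadd (s • v) (t • v)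
      simp only [hf, add_smul]
      rw [zero_add] at this
      linear_combination this
    have hder : ∀ s, HasDerivAt f (deriv f 0) s := by
      intro s
      have h1 : HasDerivAt f (deriv f 0) (s - s) := by
        rw [sub_self]; exact (hfd 0).hasDerivAt
      have h2 := (h1.comp_sub_const s s).add_const (f s)
      refine h2.congr_of_eventuallyEq (Eventually.of_forall fun t => ?_)
      simp only
      rw [← hfa, sub_add_cancel]
    have hconst : ∀ s, f s = s * deriv f 0 := by
      intro s
      have h0 : f 0 = 0 := by simp [hf]
      have := is_const_of_deriv_eq_zero (f := fun s => f s - s * deriv f 0)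
        (fun s => ((hder s).sub ((hasDerivAt_id s).mul_const _)).differentiableAt)
        (fun s => by
          have := ((hder s).sub ((hasDerivAt_id s).mul_const (deriv f 0))).deriv
          simp only [one_mul, sub_self] at this
          exact this) s 0
      simp only [h0, zero_mul, sub_zero] at this
      exact sub_eq_zero.1 this
    have e1 := hconst 1
    have e2 := hconst t
    rw [one_mul] at e1
    rw [← e1] at e2
    simpa [hf] using e2
  let Λ : (Fin g → ℂ) →ₗ[ℂ] ℂ :=
    { toFun := fun z => Ψ z - Ψ 0
      map_add' := fun z w => by
        have := hadd z w
        rw [zero_add] at this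
        linear_combination this
      map_smul' := fun t v => hsmul t v }
  have hΛ : Λ = 0 := by
    refine LinearMap.pi_ext' fun j => LinearMap.ext_ring ?_
    have : (Pi.single j 1 : Fin g → ℂ) = 0 + intVec (Pi.single j 1) := by
      rw [zero_add]
      ext i
      by_cases hij : i = j
      · subst hij; simp [intVec]
      · simp [intVec, hij]
    change Ψ (Pi.single j 1) - Ψ 0 = 0
    rw [this, hp1, sub_self]
  ext j
  have e1 : Λ (τ *ᵥ intVec (Pi.single j 1)) = 0 := by rw [hΛ]; rfl
  have e2 : Λ (τ *ᵥ intVec (Pi.single j 1)) =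
      - (2 * Real.pi * Complex.I * (intVec (Pi.single j 1) ⬝ᵥ y)) := by
    have := hp2 (Pi.single j 1) 0
    rw [zero_add] at this
    change Ψ _ - Ψ 0 = _
    rw [this]; ring
  have e3 : intVec (Pi.single j 1) ⬝ᵥ y = y j := by
    have : intVec (Pi.single j 1) = (Pi.single j 1 : Fin g → ℂ) := by
      ext i
      by_cases hij : i = j
      · subst hij; simp [intVec]
      · simp [intVec, hij]
    rw [this, single_dotProduct, one_mul]
  rw [e1, e3] at e2
  have := mul_eq_zero.1 (neg_eq_zero.1 e2.symm)
  exact this.resolve_left Complex.two_pi_I_ne_zero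

theorem RegularLogDerivAt.add_smul {ε : Fin g → ℝ} {τ : Matrix (Fin g) (Fin g) ℂ}
    (hτ : IsSiegel τ) {y₁ y₂ z₁ : Fin g → ℂ} (h₁ : RegularLogDerivAt ε τ y₁ z₁)
    (h₂ : RegularLogDerivAt ε τ y₂ z₁) (s t : ℂ) :
    RegularLogDerivAt ε τ (s • y₁ + t • y₂) z₁ := by
  obtain ⟨ψ₁, h₁⟩ := h₁
  obtain ⟨ψ₂, h₂⟩ := h₂
  refine ⟨fun z => s * ψ₁ z + t * ψ₂ z, ?_⟩
  filter_upwards [h₁, h₂] with z e₁ e₂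
  refine ⟨(e₁.1.const_mul s).add (e₂.1.const_mul t), ?_⟩
  rw [thetaSeries_add_smul_cons hτ, e₁.2, e₂.2]
  ring

/-- The directions in which the logarithmic derivative is holomorphic near a point. -/
def regularDirections (ε : Fin g → ℝ) {τ : Matrix (Fin g) (Fin g) ℂ} (hτ : IsSiegel τ)
    (z₁ : Fin g → ℂ) : Submodule ℂ (Fin g → ℂ) where
  carrier := {y | RegularLogDerivAt ε τ y z₁}
  add_mem' := fun h₁ h₂ => by simpa using h₁.add_smul hτ h₂ 1 1
  zero_mem' := ⟨0, Eventually.of_forall fun z => ⟨differentiableAt_const _, by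
    have := thetaSeries_add_smul_cons hτ 0 0 (0 : Fin g → ℂ) 0 [] ε z
    simpa using this⟩⟩
  smul_mem' := fun s _ h => by simpa using h.add_smul hτ h s 0

end RegularLogDeriv

section Nondegeneracy

variable {g : ℕ}

/-- The addition formula for two theta functions of the same level. -/
theorem thetaSeries_mul_thetaSeries_same_level {τ : Matrix (Fin g) (Fin g) ℂ} (hτ : IsSiegel τ)
    (α β : Fin g → ℝ) (p q : Fin g → ℂ) :
    thetaSeries [] α τ p * thetaSeries [] β τ q =
      ∑ ν : Fin g → Fin 2,
        thetaSeries [] (fun i => (α i + β i + ((ν i : ℕ) : ℝ)) / 2) ((2 : ℂ) • τ) (p + q) *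
          thetaSeries [] (fun i => (((ν i : ℕ) : ℝ) + α i - β i) / 2) ((2 : ℂ) • τ) (p - q) := by
  have h := thetaSeries_mul_thetaSeries one_pos one_pos hτ α β p q
  simpa [one_add_one_eq_two] using h

/-- The functions on which `∂_u ∂_w` at the origin acts as the scalar `μ`. -/
def mixedDerivEigenspace (u w : Fin g → ℂ) (μ : ℂ) : Submodule ℂ ((Fin g → ℂ) → ℂ) where
  carrier := {h | ∃ h' : ℂ → ℂ, (∀ t : ℂ, HasDerivAt (fun r : ℂ => h (t • u + r • w)) (h' t) 0) ∧
    HasDerivAt h' (μ * h 0) 0}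
  add_mem' := by
    rintro h k ⟨h', h1, h2⟩ ⟨k', k1, k2⟩
    exact ⟨fun t => h' t + k' t, fun t => (h1 t).add (k1 t),
      (h2.add k2).congr_deriv (by simp [mul_add])⟩
  zero_mem' := ⟨0, fun t => hasDerivAt_const _ _, by simp⟩
  smul_mem' := by
    rintro c h ⟨h', h1, h2⟩
    exact ⟨fun t => c * h' t, fun t => (h1 t).const_mul c, by
      simpa [mul_left_comm] using h2.const_mul c⟩

theorem thetaSeries_mem_mixedDerivEigenspace {τ : Matrix (Fin g) (Fin g) ℂ} (hτ : IsSiegel τ)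
    (ε : Fin g → ℝ) (u w s : Fin g → ℂ) (N lam : ℂ)
    (h : thetaSeries [u, w] ε τ s = lam * thetaSeries [] ε τ s) :
    (fun z => thetaSeries [] ε τ (N • z + s)) ∈ mixedDerivEigenspace u w (N ^ 2 * lam) := by
  refine ⟨fun t => N * thetaSeries [w] ε τ (s + t • (N • u)), fun t => ?_, ?_⟩
  · have h1 := hasDerivAt_thetaSeries_line hτ ε [] (s + t • (N • u)) (N • w) 0
    have h2 := thetaSeries_add_smul_cons hτ N 0 w 0 [] ε (s + t • (N • u))
    simp only [smul_zero, add_zero, zero_smul, zero_mul] at h1 h2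
    rw [h2] at h1
    have h3 : (fun r : ℂ => thetaSeries [] ε τ (N • (t • u + r • w) + s)) =
        fun r : ℂ => thetaSeries [] ε τ (s + t • (N • u) + r • (N • w)) := by
      ext r
      congr 1
      module
    change HasDerivAt (fun r : ℂ => thetaSeries [] ε τ (N • (t • u + r • w) + s)) _ 0
    rw [h3]
    exact h1
  · have h1 := (hasDerivAt_thetaSeries_line hτ ε [w] s (N • u) 0).const_mul N
    have h2 := thetaSeries_add_smul_cons hτ N 0 u 0 [w] ε s
    simp only [smul_zero, add_zero, zero_smul, zero_mul] at h1 h2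
    rw [h2, h] at h1
    refine h1.congr_deriv ?_
    change _ = N ^ 2 * lam * thetaSeries [] ε τ (N • 0 + s)
    rw [smul_zero, zero_add]
    ring

/-- The value at `(x, q)` of the product of theta functions of levels `1` and `m`. -/
noncomputable def thetaPair (m : ℕ) (c : Fin g → ℝ) (τ : Matrix (Fin g) (Fin g) ℂ)
    (x q : Fin g → ℂ) : ℂ :=
  thetaSeries [] c τ x * thetaSeries [] c ((m : ℂ) • τ) q

/-- The derivative of `z ↦ thetaPair (x + z) (q + m z)` at the origin in direction `v`. -/
noncomputable def thetaPairDeriv (m : ℕ) (c : Fin g → ℝ) (τ : Matrix (Fin g) (Fin g) ℂ)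
    (v x q : Fin g → ℂ) : ℂ :=
  thetaSeries [v] c τ x * thetaSeries [] c ((m : ℂ) • τ) q +
    m * (thetaSeries [] c τ x * thetaSeries [v] c ((m : ℂ) • τ) q)

/-- The second derivative of `z ↦ thetaPair (x + z) (q + m z)` at the origin. -/
noncomputable def thetaPairDeriv₂ (m : ℕ) (c : Fin g → ℝ) (τ : Matrix (Fin g) (Fin g) ℂ)
    (u w x q : Fin g → ℂ) : ℂ :=
  (thetaSeries [u, w] c τ x * thetaSeries [] c ((m : ℂ) • τ) q +
    m * (thetaSeries [w] c τ x * thetaSeries [u] c ((m : ℂ) • τ) q)) +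
    m * (thetaSeries [u] c τ x * thetaSeries [w] c ((m : ℂ) • τ) q +
    m * (thetaSeries [] c τ x * thetaSeries [u, w] c ((m : ℂ) • τ) q))

variable {m : ℕ} {τ : Matrix (Fin g) (Fin g) ℂ}

theorem hasDerivAt_thetaSeries_line_natCast (hτ : IsSiegel τ) (c : Fin g → ℝ)
    (ws : List (Fin g → ℂ)) (q v : Fin g → ℂ) (m : ℕ) :
    HasDerivAt (fun t : ℂ => thetaSeries ws c τ (q + (m : ℂ) • (t • v)))
      (m * thetaSeries (v :: ws) c τ q) 0 := by
  have h1 := hasDerivAt_thetaSeries_line hτ c ws q ((m : ℂ) • v) 0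
  have h2 := thetaSeries_add_smul_cons hτ (m : ℂ) 0 v 0 ws c q
  simp only [smul_zero, add_zero, zero_smul, zero_mul] at h1 h2
  rw [h2] at h1
  refine h1.congr_of_eventuallyEq (Eventually.of_forall fun t => ?_)
  simp only [smul_comm (m : ℂ) t v]

theorem hasDerivAt_thetaSeries_mul (hτ : IsSiegel τ) (hm : 0 < m) (c : Fin g → ℝ)
    (ws ws' : List (Fin g → ℂ)) (v x q : Fin g → ℂ) :
    HasDerivAt (fun t : ℂ => thetaSeries ws c τ (x + t • v) *
        thetaSeries ws' c ((m : ℂ) • τ) (q + (m : ℂ) • (t • v)))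
      (thetaSeries (v :: ws) c τ x * thetaSeries ws' c ((m : ℂ) • τ) q +
        m * (thetaSeries ws c τ x * thetaSeries (v :: ws') c ((m : ℂ) • τ) q)) 0 := by
  have h1 := hasDerivAt_thetaSeries_line hτ c ws x v 0
  have h2 := hasDerivAt_thetaSeries_line_natCast (hτ.natCast_smul hm) c ws' q v m
  refine (h1.mul h2).congr_deriv ?_
  simp only [zero_smul, smul_zero, add_zero]
  ring

theorem hasDerivAt_thetaPair (hτ : IsSiegel τ) (hm : 0 < m) (c : Fin g → ℝ)
    (v x q : Fin g → ℂ) :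
    HasDerivAt (fun t : ℂ => thetaPair m c τ (x + t • v) (q + (m : ℂ) • (t • v)))
      (thetaPairDeriv m c τ v x q) 0 :=
  hasDerivAt_thetaSeries_mul hτ hm c [] [] v x q

theorem hasDerivAt_thetaPairDeriv (hτ : IsSiegel τ) (hm : 0 < m) (c : Fin g → ℝ)
    (u w x q : Fin g → ℂ) :
    HasDerivAt (fun t : ℂ => thetaPairDeriv m c τ w (x + t • u) (q + (m : ℂ) • (t • u)))
      (thetaPairDeriv₂ m c τ u w x q) 0 :=
  (hasDerivAt_thetaSeries_mul hτ hm c [w] [] u x q).add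
    ((hasDerivAt_thetaSeries_mul hτ hm c [] [w] u x q).const_mul (m : ℂ))

theorem thetaPairDeriv_add_smul (hτ : IsSiegel τ) (hm : 0 < m) (c : Fin g → ℝ) (s t : ℂ)
    (v w x q : Fin g → ℂ) :
    thetaPairDeriv m c τ (s • v + t • w) x q =
      s * thetaPairDeriv m c τ v x q + t * thetaPairDeriv m c τ w x q := by
  simp only [thetaPairDeriv, thetaSeries_add_smul_cons hτ,
    thetaSeries_add_smul_cons (hτ.natCast_smul hm)]
  ring

/-- A product of four theta functions expands in theta functions of level `2 (m + 1)`. -/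
theorem thetaPair_mul_thetaPair_mem (hτ : IsSiegel τ) (hm : 0 < m) (c : Fin g → ℝ)
    {u w s : Fin g → ℂ} {lam : ℂ}
    (h : ∀ K : Fin g → ℤ,
      thetaSeries [u, w] (fun i => c i + K i / (2 * ((1 + m : ℕ) : ℝ)))
          ((2 : ℂ) • ((1 + m : ℕ) : ℂ) • τ) s =
        lam * thetaSeries [] (fun i => c i + K i / (2 * ((1 + m : ℕ) : ℝ)))
          ((2 : ℂ) • ((1 + m : ℕ) : ℂ) • τ) s)
    {x q x' q' : Fin g → ℂ} (hs : x + q + x' + q' = s) :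
    (fun z : Fin g → ℂ => thetaPair m c τ (x + z) (q + (m : ℂ) • z) *
      thetaPair m c τ (x' + z) (q' + (m : ℂ) • z)) ∈
      mixedDerivEigenspace u w ((2 * ((1 + m : ℕ) : ℂ)) ^ 2 * lam) := by
  have hn : IsSiegel (((1 + m : ℕ) : ℂ) • τ) := hτ.natCast_smul (by omega)
  have h2n : IsSiegel ((2 : ℂ) • ((1 + m : ℕ) : ℂ) • τ) := by
    simpa using hn.natCast_smul two_pos
  have hN : ((1 + m : ℕ) : ℝ) ≠ 0 := by positivity
  have hpair : ∀ x q : Fin g → ℂ, ∃ C : (Fin g → Fin (1 + m)) → ℂ, ∀ z : Fin g → ℂ,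
      thetaPair m c τ (x + z) (q + (m : ℂ) • z) =
        ∑ ν, C ν * thetaSeries [] (fun i => c i + ((ν i : ℕ) : ℝ) / ((1 + m : ℕ) : ℝ))
          (((1 + m : ℕ) : ℂ) • τ) (((1 + m : ℕ) : ℂ) • z + (x + q)) := by
    intro x q
    refine ⟨fun ν => thetaSeries [] (fun i => (((ν i : ℕ) : ℝ) + c i - c i) / ((1 + m : ℕ) : ℝ))
            (((1 * m * (1 + m) : ℕ) : ℂ) • τ) ((m : ℂ) • x - q), fun z => ?_⟩
    have := thetaSeries_mul_thetaSeries one_pos hm hτ c c (x + z) (q + (m : ℂ) • z)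
    rw [Nat.cast_one, one_smul] at this
    rw [thetaPair, this]
    refine Finset.sum_congr rfl fun ν _ => ?_
    rw [mul_comm]
    congr 2
    · module
    · ext i
      field_simp
      push_cast
      ring
    · push_cast; module
  obtain ⟨C, hC⟩ := hpair x q
  obtain ⟨D, hD⟩ := hpair x' q'
  have hF : (fun z : Fin g → ℂ => thetaPair m c τ (x + z) (q + (m : ℂ) • z) *
      thetaPair m c τ (x' + z) (q' + (m : ℂ) • z)) =
      ∑ ν, ∑ ν', ∑ ρ : Fin g → Fin 2, (C ν * D ν' * thetaSeries [] (fun i => (((ρ i : ℕ) : ℝ) +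
          (c i + ((ν i : ℕ) : ℝ) / ((1 + m : ℕ) : ℝ)) - (c i + ((ν' i : ℕ) : ℝ) /
            ((1 + m : ℕ) : ℝ))) / 2) ((2 : ℂ) • ((1 + m : ℕ) : ℂ) • τ) ((x + q) - (x' + q'))) •
        fun z => thetaSeries [] (fun i => c i + ((((ν i : ℕ) : ℤ) + ((ν' i : ℕ) : ℤ) +
          ((1 + m : ℕ) : ℤ) * ((ρ i : ℕ) : ℤ) : ℤ) : ℝ) / (2 * ((1 + m : ℕ) : ℝ)))
          ((2 : ℂ) • ((1 + m : ℕ) : ℂ) • τ) ((2 * ((1 + m : ℕ) : ℂ)) • z + s) := by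
    ext z
    rw [hC, hD, Finset.sum_mul_sum, Finset.sum_apply]
    refine Finset.sum_congr rfl fun ν _ => ?_
    rw [Finset.sum_apply]
    refine Finset.sum_congr rfl fun ν' _ => ?_
    rw [Finset.sum_apply, mul_mul_mul_comm, thetaSeries_mul_thetaSeries_same_level hn,
      Finset.mul_sum]
    refine Finset.sum_congr rfl fun ρ _ => ?_
    rw [Pi.smul_apply, smul_eq_mul, mul_comm (thetaSeries [] _ _ _), mul_assoc (C ν * D ν')]
    congr 3
    · module
    · ext i
      field_simp
      push_cast
      ring
    · rw [← hs]; module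
  rw [hF]
  refine Submodule.sum_mem _ fun ν _ => Submodule.sum_mem _ fun ν' _ => Submodule.sum_mem _
    fun ρ _ => Submodule.smul_mem _ _ ?_
  exact thetaSeries_mem_mixedDerivEigenspace h2n _ u w s _ lam (h _)

theorem thetaPair_eigen_identity (hτ : IsSiegel τ) (hm : 0 < m) (c : Fin g → ℝ)
    {u w x q x' q' : Fin g → ℂ} {μ : ℂ}
    (h : (fun z : Fin g → ℂ => thetaPair m c τ (x + z) (q + (m : ℂ) • z) *
      thetaPair m c τ (x' + z) (q' + (m : ℂ) • z)) ∈ mixedDerivEigenspace u w μ) :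
    thetaPairDeriv₂ m c τ u w x q * thetaPair m c τ x' q' +
      thetaPairDeriv m c τ w x q * thetaPairDeriv m c τ u x' q' +
      (thetaPairDeriv m c τ u x q * thetaPairDeriv m c τ w x' q' +
      thetaPair m c τ x q * thetaPairDeriv₂ m c τ u w x' q') =
      μ * (thetaPair m c τ x q * thetaPair m c τ x' q') := by
  obtain ⟨h', h1, h2⟩ := h
  have h3 : h' = fun t => thetaPairDeriv m c τ w (x + t • u) (q + (m : ℂ) • (t • u)) *
      thetaPair m c τ (x' + t • u) (q' + (m : ℂ) • (t • u)) +
      thetaPair m c τ (x + t • u) (q + (m : ℂ) • (t • u)) *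
      thetaPairDeriv m c τ w (x' + t • u) (q' + (m : ℂ) • (t • u)) := by
    ext t
    have e := (hasDerivAt_thetaPair hτ hm c w (x + t • u) (q + (m : ℂ) • (t • u))).mul
      (hasDerivAt_thetaPair hτ hm c w (x' + t • u) (q' + (m : ℂ) • (t • u)))
    simp only [zero_smul, smul_zero, add_zero] at e
    refine (h1 t).unique (e.congr_of_eventuallyEq (Eventually.of_forall fun r => ?_))
    simp only [Pi.mul_apply, smul_add, add_assoc]
  have e := ((hasDerivAt_thetaPairDeriv hτ hm c u w x q).mul
    (hasDerivAt_thetaPair hτ hm c u x' q')).add ((hasDerivAt_thetaPair hτ hm c u x q).mul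
    (hasDerivAt_thetaPairDeriv hτ hm c u w x' q'))
  simp only [zero_smul, smul_zero, add_zero] at e h2
  rw [h3] at h2
  exact e.unique h2

theorem regularLogDerivAt_of_thetaPairDeriv (hτ : IsSiegel τ) (hm : 0 < m) (c : Fin g → ℝ)
    {y r z₁ : Fin g → ℂ} {κ : ℂ}
    (h : ∀ x, thetaPairDeriv m c τ y x (r - x) = κ * thetaPair m c τ x (r - x))
    (hz : thetaSeries [] c ((m : ℂ) • τ) (r - z₁) ≠ 0) : RegularLogDerivAt c τ y z₁ := by
  have hd : ∀ ws : List (Fin g → ℂ),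
      Differentiable ℂ fun x => thetaSeries ws c ((m : ℂ) • τ) (r - x) := fun ws =>
    (differentiable_thetaSeries (hτ.natCast_smul hm) c ws).comp (by fun_prop)
  refine ⟨fun x => κ - m * (thetaSeries [y] c ((m : ℂ) • τ) (r - x) *
    (thetaSeries [] c ((m : ℂ) • τ) (r - x))⁻¹), ?_⟩
  filter_upwards [(hd []).continuous.continuousAt.eventually_ne hz] with x hx
  refine ⟨(differentiableAt_const _).sub (((hd [y] x).mul ((hd [] x).inv hx)).const_mul _), ?_⟩
  have e := h x
  simp only [thetaPairDeriv, thetaPair] at e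
  field_simp
  linear_combination e

/-- Values and mixed second derivatives of the theta functions of level `2n ≥ 4` satisfy no
linear relation: the theta functions embed the abelian variety to second order. -/
theorem eq_zero_of_thetaSeries_mixedDeriv_eq (hτ : IsSiegel τ) (hm : 0 < m) (c : Fin g → ℝ)
    {u w s : Fin g → ℂ} {lam : ℂ} (hu : u ≠ 0)
    (h : ∀ K : Fin g → ℤ,
      thetaSeries [u, w] (fun i => c i + K i / (2 * ((1 + m : ℕ) : ℝ)))
          ((2 : ℂ) • ((1 + m : ℕ) : ℂ) • τ) s =
        lam * thetaSeries [] (fun i => c i + K i / (2 * ((1 + m : ℕ) : ℝ)))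
          ((2 : ℂ) • ((1 + m : ℕ) : ℂ) • τ) s) : w = 0 ∧ lam = 0 := by
  set μ := (2 * ((1 + m : ℕ) : ℂ)) ^ 2 * lam with hμ
  have hmτ := hτ.natCast_smul hm
  have key : ∀ x q x' q' : Fin g → ℂ, x + q + x' + q' = s → _ := fun x q x' q' hs =>
    thetaPair_eigen_identity hτ hm c (thetaPair_mul_thetaPair_mem hτ hm c h hs)
  have hdf : Dense {z | thetaSeries [] c τ z ≠ 0} :=
    (differentiable_thetaSeries hτ c []).dense_ne_zero (exists_thetaSeries_ne_zero hτ c)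
  have hk : Differentiable ℂ (thetaSeries [] c ((m : ℂ) • τ)) := differentiable_thetaSeries hmτ c []
  obtain ⟨k₀, hk₀⟩ := exists_thetaSeries_ne_zero hmτ c
  have hex : ∀ r : Fin g → ℂ, ∃ x, thetaPair m c τ x (r - x) ≠ 0 := by
    intro r
    obtain ⟨x, hx1, hx2⟩ := hdf.inter_open_nonempty
      {x | thetaSeries [] c ((m : ℂ) • τ) (r - x) ≠ 0}
      (isOpen_ne_fun (hk.continuous.comp (continuous_const.sub continuous_id)) continuous_const)
      ⟨r - k₀, by simpa using hk₀⟩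
    exact ⟨x, mul_ne_zero hx2 hx1⟩
  have hy : ∀ x₁ x₂ r : Fin g → ℂ,
      (thetaPair m c τ x₂ (s - r - x₂) * thetaPairDeriv m c τ u x₁ (s - r - x₁) -
        thetaPair m c τ x₁ (s - r - x₁) * thetaPairDeriv m c τ u x₂ (s - r - x₂)) • w +
      (thetaPair m c τ x₂ (s - r - x₂) * thetaPairDeriv m c τ w x₁ (s - r - x₁) -
        thetaPair m c τ x₁ (s - r - x₁) * thetaPairDeriv m c τ w x₂ (s - r - x₂)) • u = 0 := by
    intro x₁ x₂ r
    refine eq_zero_of_regularLogDerivAt hτ c fun z₁ => ?_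
    have hdk : Dense {r | thetaSeries [] c ((m : ℂ) • τ) (r - z₁) ≠ 0} :=
      Differentiable.dense_ne_zero (F := fun r => thetaSeries [] c ((m : ℂ) • τ) (r - z₁))
        (hk.comp (by fun_prop)) ⟨k₀ + z₁, by simpa using hk₀⟩
    have hct : ∀ ws x, Continuous fun r => thetaSeries ws c ((m : ℂ) • τ) (s - r - x) :=
      fun ws x => (differentiable_thetaSeries hmτ c ws).continuous.comp (by fun_prop)
    have hcl : IsClosed ((fun r => (thetaPair m c τ x₂ (s - r - x₂) *
        thetaPairDeriv m c τ u x₁ (s - r - x₁) -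
        thetaPair m c τ x₁ (s - r - x₁) * thetaPairDeriv m c τ u x₂ (s - r - x₂)) • w +
      (thetaPair m c τ x₂ (s - r - x₂) * thetaPairDeriv m c τ w x₁ (s - r - x₁) -
        thetaPair m c τ x₁ (s - r - x₁) * thetaPairDeriv m c τ w x₂ (s - r - x₂)) • u) ⁻¹'
        (regularDirections c hτ z₁ : Set (Fin g → ℂ))) := by
      refine (Submodule.closed_of_finiteDimensional _).preimage ?_
      have := hct []
      have := hct [u]
      have := hct [w]
      simp only [thetaPair, thetaPairDeriv]
      fun_prop
    refine hcl.closure_subset_iff.2 ?_ (hdk r)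
    intro r hr
    refine regularLogDerivAt_of_thetaPairDeriv hτ hm c (r := r)
      (κ := -(thetaPair m c τ x₂ (s - r - x₂) * thetaPairDeriv₂ m c τ u w x₁ (s - r - x₁) -
        thetaPair m c τ x₁ (s - r - x₁) * thetaPairDeriv₂ m c τ u w x₂ (s - r - x₂)))
      (fun x => ?_) hr
    have e1 := key x (r - x) x₁ (s - r - x₁) (by abel)
    have e2 := key x (r - x) x₂ (s - r - x₂) (by abel)
    rw [thetaPairDeriv_add_smul hτ hm]
    linear_combination thetaPair m c τ x₂ (s - r - x₂) * e1 -
      thetaPair m c τ x₁ (s - r - x₁) * e2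
  have hw : w = 0 := by
    obtain ⟨j, hj⟩ := Function.ne_iff.1 hu
    have hy2 : w j • u + u j • w = 0 := by
      refine eq_zero_of_regularLogDerivAt hτ c fun z₁ => ?_
      obtain ⟨x₂, hx₂⟩ := hex (k₀ + z₁)
      refine regularLogDerivAt_of_thetaPairDeriv hτ hm c (r := k₀ + z₁)
        (κ := thetaPairDeriv m c τ (w j • u + u j • w) x₂ (k₀ + z₁ - x₂) /
          thetaPair m c τ x₂ (k₀ + z₁ - x₂)) (fun x => ?_) (by simpa using hk₀)
      have e := congrFun (hy x x₂ (s - (k₀ + z₁))) j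
      simp only [sub_sub_cancel, Pi.add_apply, Pi.smul_apply, smul_eq_mul, Pi.zero_apply] at e
      field_simp
      simp only [thetaPairDeriv_add_smul hτ hm]
      linear_combination e
    have e := congrFun hy2 j
    simp only [Pi.add_apply, Pi.smul_apply, smul_eq_mul, Pi.zero_apply] at e
    have hwj : w j = 0 := by
      have : w j * (2 * u j) = 0 := by linear_combination e
      exact (mul_eq_zero.1 this).resolve_right (mul_ne_zero two_ne_zero hj)
    rw [hwj, zero_smul, zero_add] at hy2
    exact (smul_eq_zero.1 hy2).resolve_left hj
  refine ⟨hw, ?_⟩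
  obtain ⟨x, hx⟩ := hex 0
  obtain ⟨x', hx'⟩ := hex s
  have e := key x (0 - x) x' (s - x') (by abel)
  have z1 : ∀ {σ : Matrix (Fin g) (Fin g) ℂ}, IsSiegel σ → ∀ ws z,
      thetaSeries ((0 : Fin g → ℂ) :: ws) c σ z = 0 := fun hσ ws z => by
    have := thetaSeries_add_smul_cons hσ 0 0 (0 : Fin g → ℂ) 0 ws c z
    simpa using this
  subst hw
  simp only [thetaPairDeriv, thetaPairDeriv₂, z1 hτ, z1 hmτ, thetaSeries_swap u] at e
  have hμ0 : μ = 0 := by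
    have : μ * (thetaPair m c τ x (0 - x) * thetaPair m c τ x' (s - x')) = 0 := by
      rw [← e]; ring
    exact (mul_eq_zero.1 this).resolve_right (mul_ne_zero hx hx')
  refine (mul_eq_zero.1 hμ0).resolve_left (pow_ne_zero _ (mul_ne_zero two_ne_zero ?_))
  exact_mod_cast (by omega : (1 + m) ≠ 0)

end Nondegeneracy

section Reconstruction

variable {g : ℕ}

/-- If the decomposable forms `x ∧ D₁`, `x ∧ D₂` are both divisible by `y` and `x, D₁, D₂` are
linearly independent, then `x` is proportional to `y`. -/
theorem exists_smul_eq_of_wedge_eq {ι : Type*} {x D₁ D₂ y E₁ E₂ : ι → ℂ}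
    (h₁ : ∀ A B, D₁ A * x B - x A * D₁ B = E₁ A * y B - y A * E₁ B)
    (h₂ : ∀ A B, D₂ A * x B - x A * D₂ B = E₂ A * y B - y A * E₂ B)
    (hli : ∀ a b c : ℂ, (∀ A, a * x A + b * D₁ A + c * D₂ A = 0) → a = 0 ∧ b = 0 ∧ c = 0) :
    ∃ t : ℂ, t ≠ 0 ∧ ∀ A, x A = t * y A := by
  have hx : ∃ B, x B ≠ 0 := by
    by_contra! h
    exact one_ne_zero (hli 1 0 0 fun A => by simp [h]).1
  obtain ⟨B₁, hB₁⟩ := hx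
  have hy : ∃ B, y B ≠ 0 := by
    by_contra! h
    refine hB₁ (hli (-D₁ B₁) (x B₁) 0 fun A => ?_).2.1
    have := h₁ A B₁
    simp only [h] at this
    linear_combination this
  obtain ⟨B, hB⟩ := hy
  have hprop : ∀ A, x A * y B - x B * y A = 0 := by
    by_contra! h
    obtain ⟨A, hA⟩ := h
    have c₁ : ∀ C, D₁ C * (x A * y B - x B * y A) - x C * (D₁ A * y B - D₁ B * y A) =
        -(y C * (E₁ A * y B - E₁ B * y A)) := fun C => by
      linear_combination y B * h₁ C A - y A * h₁ C B
    have c₂ : ∀ C, D₂ C * (x A * y B - x B * y A) - x C * (D₂ A * y B - D₂ B * y A) =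
        -(y C * (E₂ A * y B - E₂ B * y A)) := fun C => by
      linear_combination y B * h₂ C A - y A * h₂ C B
    have e := hli
      ((E₁ A * y B - E₁ B * y A) * (D₂ A * y B - D₂ B * y A) -
        (E₂ A * y B - E₂ B * y A) * (D₁ A * y B - D₁ B * y A))
      ((E₂ A * y B - E₂ B * y A) * (x A * y B - x B * y A))
      (-((E₁ A * y B - E₁ B * y A) * (x A * y B - x B * y A)))
      fun C => by
        linear_combination (E₂ A * y B - E₂ B * y A) * c₁ C - (E₁ A * y B - E₁ B * y A) * c₂ C
    have e₁ : E₁ A * y B - E₁ B * y A = 0 :=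
      (mul_eq_zero.1 (neg_eq_zero.1 e.2.2)).resolve_right hA
    refine hA (hli (-(D₁ A * y B - D₁ B * y A)) (x A * y B - x B * y A) 0 fun C => ?_).2.1
    linear_combination c₁ C - y C * e₁
  refine ⟨x B / y B, fun h0 => hB₁ ?_, fun A => ?_⟩
  · have h := hprop B₁
    have hxB : x B = 0 := (div_eq_zero_iff.1 h0).resolve_right hB
    rw [hxB, zero_mul, sub_zero] at h
    exact (mul_eq_zero.1 h).resolve_right hB
  · field_simp
    linear_combination hprop A

variable {τ : Matrix (Fin g) (Fin g) ℂ}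

theorem toComplexVec_add_self {σ : Fin g → ℝ} {l : Fin g → ℤ} (hσ : ∀ i, σ i = l i / 2) :
    toComplexVec σ + toComplexVec σ = intVec l := by
  ext i
  simp only [toComplexVec, intVec, Pi.add_apply, hσ]
  push_cast
  ring

theorem thetaSeries_mul_sub_mul (hτ : IsSiegel τ) (A B : Fin g → ℝ) {σ : Fin g → ℝ}
    {l : Fin g → ℤ} (hσ : ∀ i, σ i = l i / 2) (u w : Fin g → ℂ) :
    thetaSeries [u, w] A τ (toComplexVec σ) * thetaSeries [] B τ (toComplexVec σ) +
      thetaSeries [w] A τ (toComplexVec σ) * thetaSeries [u] B τ (toComplexVec σ) -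
      (thetaSeries [u] A τ (toComplexVec σ) * thetaSeries [w] B τ (toComplexVec σ) +
      thetaSeries [] A τ (toComplexVec σ) * thetaSeries [u, w] B τ (toComplexVec σ)) =
    ∑ ν : Fin g → Fin 2,
      4 * expTwoPiI (toComplexVec (fun i => (A i + B i + ((ν i : ℕ) : ℝ)) / 2) ⬝ᵥ intVec l) *
        (thetaSeries [u] (fun i => (A i + B i + ((ν i : ℕ) : ℝ)) / 2) ((2 : ℂ) • τ) 0 *
          thetaSeries [w] (fun i => (((ν i : ℕ) : ℝ) + A i - B i) / 2) ((2 : ℂ) • τ) 0) := by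
  have h2τ : IsSiegel ((2 : ℂ) • τ) := by simpa using hτ.natCast_smul two_pos
  set s := toComplexVec σ with hs
  have hline : ∀ (ws : List (Fin g → ℂ)) (A : Fin g → ℝ) (z v : Fin g → ℂ),
      HasDerivAt (fun t : ℂ => thetaSeries ws A τ (z + t • v)) (thetaSeries (v :: ws) A τ z) 0 :=
    fun ws A z v => by simpa using hasDerivAt_thetaSeries_line hτ A ws z v 0
  have hneg : ∀ (A : Fin g → ℝ) (z v : Fin g → ℂ),
      HasDerivAt (fun t : ℂ => thetaSeries [] A τ (z - t • v)) (-thetaSeries [v] A τ z) 0 := by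
    intro A z v
    have h1 := hline [] A z (-v)
    have h2 := thetaSeries_add_smul_cons hτ (-1) 0 v 0 [] A z
    simp only [smul_zero, add_zero, zero_mul, neg_smul, one_smul, neg_mul, one_mul] at h2
    rw [h2] at h1
    simpa [sub_eq_add_neg] using h1
  have hdouble : ∀ (A : Fin g → ℝ) (v : Fin g → ℂ),
      HasDerivAt (fun t : ℂ => thetaSeries [] A ((2 : ℂ) • τ) (t • v + t • v))
        (2 * thetaSeries [v] A ((2 : ℂ) • τ) 0) 0 := by
    intro A v
    have h1 := hasDerivAt_thetaSeries_line_natCast h2τ A [] 0 v 2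
    simpa [two_smul] using h1
  have hprod : ∀ z ζ : Fin g → ℂ,
      thetaSeries [] A τ (s + z + ζ) * thetaSeries [] B τ (s + z - ζ) =
      ∑ ν : Fin g → Fin 2,
        expTwoPiI (toComplexVec (fun i => (A i + B i + ((ν i : ℕ) : ℝ)) / 2) ⬝ᵥ intVec l) *
        thetaSeries [] (fun i => (A i + B i + ((ν i : ℕ) : ℝ)) / 2) ((2 : ℂ) • τ) (z + z) *
          thetaSeries [] (fun i => (((ν i : ℕ) : ℝ) + A i - B i) / 2) ((2 : ℂ) • τ) (ζ + ζ) := by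
    intro z ζ
    rw [thetaSeries_mul_thetaSeries_same_level hτ]
    refine Finset.sum_congr rfl fun ν _ => ?_
    rw [← thetaSeries_add_intVec, ← toComplexVec_add_self hσ, ← hs]
    congr 2 <;> abel
  have hfirst : ∀ t : ℂ,
      thetaSeries [w] A τ (s + t • u) * thetaSeries [] B τ (s + t • u) -
        thetaSeries [] A τ (s + t • u) * thetaSeries [w] B τ (s + t • u) =
      ∑ ν : Fin g → Fin 2,
        expTwoPiI (toComplexVec (fun i => (A i + B i + ((ν i : ℕ) : ℝ)) / 2) ⬝ᵥ intVec l) *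
        thetaSeries [] (fun i => (A i + B i + ((ν i : ℕ) : ℝ)) / 2) ((2 : ℂ) • τ)
          (t • u + t • u) *
        (2 * thetaSeries [w] (fun i => (((ν i : ℕ) : ℝ) + A i - B i) / 2) ((2 : ℂ) • τ) 0) := by
    intro t
    have h1 := (hline [] A (s + t • u) w).mul (hneg B (s + t • u) w)
    have h2 := HasDerivAt.fun_sum (u := Finset.univ) fun (ν : Fin g → Fin 2) _ =>
      (hdouble (fun i => (((ν i : ℕ) : ℝ) + A i - B i) / 2) w).const_mul
        (expTwoPiI (toComplexVec (fun i => (A i + B i + ((ν i : ℕ) : ℝ)) / 2) ⬝ᵥ intVec l) *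
        thetaSeries [] (fun i => (A i + B i + ((ν i : ℕ) : ℝ)) / 2) ((2 : ℂ) • τ)
          (t • u + t • u))
    have h3 := h1.unique (h2.congr_of_eventuallyEq (Eventually.of_forall fun r => hprod _ _))
    simp only [zero_smul, add_zero, sub_zero] at h3
    rw [← h3]
    ring
  have h1 := ((hline [w] A s u).mul (hline [] B s u)).sub ((hline [] A s u).mul (hline [w] B s u))
  have h2 := HasDerivAt.fun_sum (u := Finset.univ) fun (ν : Fin g → Fin 2) _ =>
    (((hdouble (fun i => (A i + B i + ((ν i : ℕ) : ℝ)) / 2) u).const_mul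
      (expTwoPiI (toComplexVec (fun i => (A i + B i + ((ν i : ℕ) : ℝ)) / 2) ⬝ᵥ
        intVec l))).mul_const
      (2 * thetaSeries [w] (fun i => (((ν i : ℕ) : ℝ) + A i - B i) / 2) ((2 : ℂ) • τ) 0))
  have h3 := h1.unique (h2.congr_of_eventuallyEq (Eventually.of_forall fun t => hfirst t))
  simp only [zero_smul, add_zero] at h3
  rw [h3]
  refine Finset.sum_congr rfl fun ν _ => ?_
  ring

/-- The second order Wronskians of theta functions of level `2n` are quadratic expressions in the
gradients of theta functions of level `4n`. -/
theorem thetaSeries_wronskian (hτ : IsSiegel τ) (A B : Fin g → ℝ) {σ : Fin g → ℝ}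
    {l : Fin g → ℤ} (hσ : ∀ i, σ i = l i / 2) (u w : Fin g → ℂ) :
    thetaSeries [u, w] A τ (toComplexVec σ) * thetaSeries [] B τ (toComplexVec σ) -
      thetaSeries [] A τ (toComplexVec σ) * thetaSeries [u, w] B τ (toComplexVec σ) =
    ∑ ν : Fin g → Fin 2,
      2 * expTwoPiI (toComplexVec (fun i => (A i + B i + ((ν i : ℕ) : ℝ)) / 2) ⬝ᵥ intVec l) *
        (thetaSeries [u] (fun i => (A i + B i + ((ν i : ℕ) : ℝ)) / 2) ((2 : ℂ) • τ) 0 *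
          thetaSeries [w] (fun i => (((ν i : ℕ) : ℝ) + A i - B i) / 2) ((2 : ℂ) • τ) 0 +
        thetaSeries [w] (fun i => (A i + B i + ((ν i : ℕ) : ℝ)) / 2) ((2 : ℂ) • τ) 0 *
          thetaSeries [u] (fun i => (((ν i : ℕ) : ℝ) + A i - B i) / 2) ((2 : ℂ) • τ) 0) := by
  have h1 := thetaSeries_mul_sub_mul hτ A B hσ u w
  have h2 := thetaSeries_mul_sub_mul hτ A B hσ w u
  rw [thetaSeries_swap w u, thetaSeries_swap w u] at h2
  rw [← mul_right_inj' (two_ne_zero (α := ℂ)), Finset.mul_sum]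
  have h3 : ∀ ν : Fin g → Fin 2, _ = _ := fun ν => (show
      2 * (2 * expTwoPiI (toComplexVec (fun i => (A i + B i + ((ν i : ℕ) : ℝ)) / 2) ⬝ᵥ
        intVec l) *
        (thetaSeries [u] (fun i => (A i + B i + ((ν i : ℕ) : ℝ)) / 2) ((2 : ℂ) • τ) 0 *
          thetaSeries [w] (fun i => (((ν i : ℕ) : ℝ) + A i - B i) / 2) ((2 : ℂ) • τ) 0 +
        thetaSeries [w] (fun i => (A i + B i + ((ν i : ℕ) : ℝ)) / 2) ((2 : ℂ) • τ) 0 *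
          thetaSeries [u] (fun i => (((ν i : ℕ) : ℝ) + A i - B i) / 2) ((2 : ℂ) • τ) 0)) =
      4 * expTwoPiI (toComplexVec (fun i => (A i + B i + ((ν i : ℕ) : ℝ)) / 2) ⬝ᵥ intVec l) *
        (thetaSeries [u] (fun i => (A i + B i + ((ν i : ℕ) : ℝ)) / 2) ((2 : ℂ) • τ) 0 *
          thetaSeries [w] (fun i => (((ν i : ℕ) : ℝ) + A i - B i) / 2) ((2 : ℂ) • τ) 0) +
      4 * expTwoPiI (toComplexVec (fun i => (A i + B i + ((ν i : ℕ) : ℝ)) / 2) ⬝ᵥ intVec l) *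
        (thetaSeries [w] (fun i => (A i + B i + ((ν i : ℕ) : ℝ)) / 2) ((2 : ℂ) • τ) 0 *
          thetaSeries [u] (fun i => (((ν i : ℕ) : ℝ) + A i - B i) / 2) ((2 : ℂ) • τ) 0) by ring)
  rw [Finset.sum_congr rfl fun ν _ => h3 ν, Finset.sum_add_distrib, ← h1, ← h2]
  ring

theorem thetaGradient_eq_thetaSeries {n : ℕ} (hn : 0 < n) (τ : SiegelUpperHalfSpace g) (i : Fin g)
    (k : Fin g → Fin (4 * n)) :
    thetaGradient n τ i k = thetaSeries [Pi.single i 1]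
      (fun j => ((k j : ℕ) : ℝ) / ((4 * n : ℕ) : ℝ)) ((4 * n : ℂ) • τ.1) 0 := by
  have hτ : IsSiegel ((4 * n : ℂ) • τ.1) := by
    have : IsSiegel τ.1 := τ.2
    simpa using this.natCast_smul (show 0 < 4 * n by omega)
  have h0 : toComplexVec (0 : Fin g → ℝ) = 0 := by ext i; simp [toComplexVec]
  simp only [thetaGradient, riemannTheta_eq_thetaSeries, h0, add_zero, lineDeriv]
  simpa using (hasDerivAt_thetaSeries_line hτ (fun j => ((k j : ℕ) : ℝ) / ((4 * n : ℕ) : ℝ)) [] 0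
    (Pi.single i 1) 0).deriv

/-- Equality of the gradient maps expresses each row of gradients at `τ` as a directional
derivative at `τ'`. -/
theorem exists_direction_of_gradientThetaMap_eq {n : ℕ} (hn : 0 < n)
    {τ τ' : SiegelUpperHalfSpace g} (h : gradientThetaMap n τ = gradientThetaMap n τ')
    (i : Fin g) : ∃ v : Fin g → ℂ, ∀ (ε : Fin g → ℝ) (K : Fin g → ℤ),
      (∀ j, ε j = K j / (4 * n)) →
      thetaSeries [Pi.single i 1] ε ((2 : ℂ) • (2 : ℂ) • (n : ℂ) • τ.1) 0 =
        thetaSeries [v] ε ((2 : ℂ) • (2 : ℂ) • (n : ℂ) • τ'.1) 0 := by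
  have hmem : thetaGradient n τ i ∈ Submodule.span ℂ (Set.range (thetaGradient n τ')) := by
    have h1 : thetaGradient n τ i ∈ gradientThetaMap n τ := Submodule.subset_span ⟨i, rfl⟩
    rw [h] at h1
    exact h1
  obtain ⟨c, hc⟩ := Submodule.mem_span_range_iff_exists_fun ℂ |>.1 hmem
  have hsmul : ∀ M : Matrix (Fin g) (Fin g) ℂ,
      (2 : ℂ) • (2 : ℂ) • (n : ℂ) • M = (4 * n : ℂ) • M := fun M => by
    rw [smul_smul, smul_smul]; congr 1; ring
  have hτ' : IsSiegel ((4 * n : ℂ) • τ'.1) := by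
    have : IsSiegel τ'.1 := τ'.2
    simpa using this.natCast_smul (show 0 < 4 * n by omega)
  refine ⟨∑ j, c j • Pi.single j 1, fun ε K hε => ?_⟩
  rw [hsmul, hsmul]
  have hN : (0 : ℤ) < 4 * n := by omega
  have hlt : ∀ j, (K j % (4 * n : ℤ)).toNat < 4 * n := fun j => by
    have := Int.emod_lt_of_pos (K j) hN
    have := Int.emod_nonneg (K j) hN.ne'
    omega
  have hε' : ε = fun j => (((⟨_, hlt j⟩ : Fin (4 * n)) : ℕ) : ℝ) / ((4 * n : ℕ) : ℝ) +
      ((K j / (4 * n : ℤ) : ℤ) : ℝ) := by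
    ext j
    have e1 : (((K j % (4 * n : ℤ)).toNat : ℕ) : ℝ) = ((K j % (4 * n : ℤ) : ℤ) : ℝ) := by
      rw [← Int.cast_natCast, Int.toNat_of_nonneg (Int.emod_nonneg (K j) hN.ne')]
    have e2 : ((K j % (4 * n : ℤ) : ℤ) : ℝ) + (4 * n) * ((K j / (4 * n : ℤ) : ℤ) : ℝ) = K j := by
      exact_mod_cast Int.emod_add_mul_ediv (K j) (4 * n)
    have hn' : (n : ℝ) ≠ 0 := by exact_mod_cast hn.ne'
    simp only [hε, e1]
    push_cast
    field_simp
    linarith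
  rw [hε', thetaSeries_add_int _ (fun j => (((⟨_, hlt j⟩ : Fin (4 * n)) : ℕ) : ℝ) /
      ((4 * n : ℕ) : ℝ)) (fun j => K j / (4 * n : ℤ)),
    thetaSeries_add_int _ (fun j => (((⟨_, hlt j⟩ : Fin (4 * n)) : ℕ) : ℝ) /
      ((4 * n : ℕ) : ℝ)) (fun j => K j / (4 * n : ℤ)),
    ← thetaGradient_eq_thetaSeries hn τ i fun j => ⟨_, hlt j⟩, thetaSeries_sum_cons _ hτ', ← hc,
    Finset.sum_apply]
  refine Finset.sum_congr rfl fun j _ => ?_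
  rw [Pi.smul_apply, smul_eq_mul, thetaGradient_eq_thetaSeries hn]

/-- The gradients of level `4n` determine the projective point formed by the theta constants of
level `2n` whose characteristics lie in a fixed coset of `(1/2n)ℤ^g`. -/
theorem exists_smul_thetaSeries_eq {m : ℕ} (hg : 2 ≤ g) (hm : 0 < m)
    {τ τ' : SiegelUpperHalfSpace g}
    (h : gradientThetaMap (1 + m) τ = gradientThetaMap (1 + m) τ')
    {c σ : Fin g → ℝ} {l k : Fin g → ℤ} (hσ : ∀ i, σ i = l i / 2)
    (hc : ∀ i, 2 * c i = k i / (2 * ((1 + m : ℕ) : ℝ))) :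
    ∃ t : ℂ, t ≠ 0 ∧ ∀ K : Fin g → ℤ,
      thetaSeries [] (fun i => c i + K i / (2 * ((1 + m : ℕ) : ℝ)))
          ((2 : ℂ) • ((1 + m : ℕ) : ℂ) • τ.1) (toComplexVec σ) =
        t * thetaSeries [] (fun i => c i + K i / (2 * ((1 + m : ℕ) : ℝ)))
          ((2 : ℂ) • ((1 + m : ℕ) : ℂ) • τ'.1) (toComplexVec σ) := by
  have hS : ∀ τ : SiegelUpperHalfSpace g, IsSiegel ((2 : ℂ) • ((1 + m : ℕ) : ℂ) • τ.1) := by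
    intro τ
    have h1 : IsSiegel τ.1 := τ.2
    simpa using (h1.natCast_smul (show 0 < 1 + m by omega)).natCast_smul two_pos
  have hN : ((1 + m : ℕ) : ℝ) ≠ 0 := by positivity
  choose v hv using exists_direction_of_gradientThetaMap_eq (by omega) h
  have hW : ∀ (i j : Fin g) (A B : Fin g → ℤ),
      thetaSeries [Pi.single i 1, Pi.single j 1] (fun i => c i + A i / (2 * ((1 + m : ℕ) : ℝ)))
          ((2 : ℂ) • ((1 + m : ℕ) : ℂ) • τ.1) (toComplexVec σ) *
        thetaSeries [] (fun i => c i + B i / (2 * ((1 + m : ℕ) : ℝ)))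
          ((2 : ℂ) • ((1 + m : ℕ) : ℂ) • τ.1) (toComplexVec σ) -
        thetaSeries [] (fun i => c i + A i / (2 * ((1 + m : ℕ) : ℝ)))
          ((2 : ℂ) • ((1 + m : ℕ) : ℂ) • τ.1) (toComplexVec σ) *
        thetaSeries [Pi.single i 1, Pi.single j 1] (fun i => c i + B i / (2 * ((1 + m : ℕ) : ℝ)))
          ((2 : ℂ) • ((1 + m : ℕ) : ℂ) • τ.1) (toComplexVec σ) =
      thetaSeries [v i, v j] (fun i => c i + A i / (2 * ((1 + m : ℕ) : ℝ)))
          ((2 : ℂ) • ((1 + m : ℕ) : ℂ) • τ'.1) (toComplexVec σ) *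
        thetaSeries [] (fun i => c i + B i / (2 * ((1 + m : ℕ) : ℝ)))
          ((2 : ℂ) • ((1 + m : ℕ) : ℂ) • τ'.1) (toComplexVec σ) -
        thetaSeries [] (fun i => c i + A i / (2 * ((1 + m : ℕ) : ℝ)))
          ((2 : ℂ) • ((1 + m : ℕ) : ℂ) • τ'.1) (toComplexVec σ) *
        thetaSeries [v i, v j] (fun i => c i + B i / (2 * ((1 + m : ℕ) : ℝ)))
          ((2 : ℂ) • ((1 + m : ℕ) : ℂ) • τ'.1) (toComplexVec σ) := by
    intro i j A B
    rw [thetaSeries_wronskian (hS τ) _ _ hσ, thetaSeries_wronskian (hS τ') _ _ hσ]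
    refine Finset.sum_congr rfl fun ν _ => ?_
    have e1 : ∀ i, (c i + A i / (2 * ((1 + m : ℕ) : ℝ)) + (c i + B i / (2 * ((1 + m : ℕ) : ℝ))) +
        ((ν i : ℕ) : ℝ)) / 2 = ((k i + A i + B i + 2 * ((1 + m : ℕ) : ℤ) * ((ν i : ℕ) : ℤ) : ℤ) : ℝ)
          / (4 * ((1 + m : ℕ) : ℝ)) := by
      intro i
      have e : c i = k i / (4 * ((1 + m : ℕ) : ℝ)) := by
        have := hc i
        field_simp at this ⊢
        linarith
      rw [e]
      push_cast at hN ⊢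
      field_simp
      ring
    have e2 : ∀ i, (((ν i : ℕ) : ℝ) + (c i + A i / (2 * ((1 + m : ℕ) : ℝ))) -
        (c i + B i / (2 * ((1 + m : ℕ) : ℝ)))) / 2 =
        ((A i - B i + 2 * ((1 + m : ℕ) : ℤ) * ((ν i : ℕ) : ℤ) : ℤ) : ℝ)
          / (4 * ((1 + m : ℕ) : ℝ)) := by
      intro i
      push_cast at hN ⊢
      field_simp
      ring
    rw [hv i _ _ e1, hv i _ _ e2, hv j _ _ e1, hv j _ _ e2]
  let i₀ : Fin g := ⟨0, by omega⟩
  let i₁ : Fin g := ⟨1, by omega⟩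
  have hi : i₁ ≠ i₀ := by simp [i₀, i₁]
  refine exists_smul_eq_of_wedge_eq (hW i₀ i₀) (hW i₀ i₁) fun a b d hlin => ?_
  have hne : (Pi.single i₀ 1 : Fin g → ℂ) ≠ 0 := by simp
  have hnd := eq_zero_of_thetaSeries_mixedDeriv_eq (m := m) τ.2 hm c (s := toComplexVec σ)
    (w := b • Pi.single i₀ 1 + d • Pi.single i₁ 1) (lam := -a) hne fun K => by
      rw [thetaSeries_swap, thetaSeries_add_smul_cons (hS τ),
        thetaSeries_swap (Pi.single i₁ 1) (Pi.single i₀ 1)]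
      linear_combination hlin K
  refine ⟨neg_eq_zero.1 hnd.2, ?_, ?_⟩
  · simpa [hi, hi.symm] using congrFun hnd.1 i₀
  · simpa [hi, hi.symm] using congrFun hnd.1 i₁

end Reconstruction

theorem mainTheorem4 (g n : ℕ) (hg : 2 ≤ g) (hn : 2 ≤ n)
    (σ δ : Fin g → ℝ) (hσ : IsCharOfOrder 2 σ) (hδ : IsCharOfOrder 2 δ)
    (a b : Fin g → ℝ) (ha : IsCharOfOrder (2 * n) a) (hb : IsCharOfOrder (2 * n) b)
    (hab : IsCharOfOrder n (a + b - (n : ℝ)⁻¹ • δ))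
    (τ τ' : SiegelUpperHalfSpace g)
    (hΦ : gradientThetaMap n τ = gradientThetaMap n τ') :
    ∃ t : ℂ, t ≠ 0 ∧ ∀ γ : Fin g → ℝ, IsCharOfOrder 2 γ →
      riemannTheta a (γ + σ) ((n : ℂ) • τ.1) 0 * riemannTheta b γ ((n : ℂ) • τ.1) 0 =
        t * (riemannTheta a (γ + σ) ((n : ℂ) • τ'.1) 0 *
          riemannTheta b γ ((n : ℂ) • τ'.1) 0) := by
  obtain ⟨m, rfl⟩ : ∃ m, n = 1 + m := ⟨n - 1, by omega⟩
  choose l hl using hσ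
  choose ka hka using ha
  choose kb hkb using hb
  have hN : ((1 + m : ℕ) : ℝ) ≠ 0 := by positivity
  obtain ⟨t, ht, hx⟩ := exists_smul_thetaSeries_eq (m := m) hg (by omega) hΦ
    (c := fun i => (a i + b i) / 2) (σ := σ) (l := l) (k := fun i => ka i + kb i)
    (fun i => by simpa using hl i) (fun i => by
      rw [hka, hkb]; push_cast; field_simp)
  refine ⟨t ^ 2, pow_ne_zero 2 ht, fun γ hγ => ?_⟩
  choose lγ hlγ using hγ
  have hS : ∀ τ : SiegelUpperHalfSpace g, IsSiegel (((1 + m : ℕ) : ℂ) • τ.1) := fun τ => by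
    have h1 : IsSiegel τ.1 := τ.2
    exact h1.natCast_smul (by omega)
  have hprod : ∀ τ : SiegelUpperHalfSpace g,
      riemannTheta a (γ + σ) (((1 + m : ℕ) : ℂ) • τ.1) 0 *
        riemannTheta b γ (((1 + m : ℕ) : ℂ) • τ.1) 0 =
      ∑ ν : Fin g → Fin 2,
        expTwoPiI (toComplexVec (fun i => (a i + b i + ((ν i : ℕ) : ℝ)) / 2) ⬝ᵥ intVec lγ) *
        (thetaSeries [] (fun i => (a i + b i) / 2 + ((((1 + m : ℕ) : ℤ) * ((ν i : ℕ) : ℤ) : ℤ) : ℝ) /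
            (2 * ((1 + m : ℕ) : ℝ))) ((2 : ℂ) • ((1 + m : ℕ) : ℂ) • τ.1) (toComplexVec σ) *
          thetaSeries [] (fun i => (a i + b i) / 2 +
            ((((1 + m : ℕ) : ℤ) * ((ν i : ℕ) : ℤ) - kb i : ℤ) : ℝ) /
            (2 * ((1 + m : ℕ) : ℝ))) ((2 : ℂ) • ((1 + m : ℕ) : ℂ) • τ.1) (toComplexVec σ)) := by
    intro τ
    have hγ2 := toComplexVec_add_self (σ := γ) (l := lγ) fun i => by simpa using hlγ i
    have hadd : toComplexVec (γ + σ) = toComplexVec γ + toComplexVec σ := by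
      ext i; simp [toComplexVec]
    rw [riemannTheta_eq_thetaSeries, riemannTheta_eq_thetaSeries, zero_add, zero_add,
      thetaSeries_mul_thetaSeries_same_level (hS τ)]
    refine Finset.sum_congr rfl fun ν _ => ?_
    have e1 : toComplexVec (γ + σ) + toComplexVec γ = toComplexVec σ + intVec lγ := by
      rw [← hγ2, hadd]; abel
    have e2 : toComplexVec (γ + σ) - toComplexVec γ = toComplexVec σ := by
      rw [hadd]; abel
    rw [e1, e2, thetaSeries_add_intVec, mul_assoc]
    congr 3
    · ext i
      push_cast at hN ⊢
      field_simp
    · ext i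
      have := hkb i
      push_cast at this hN ⊢
      field_simp at this ⊢
      linarith
  rw [hprod, hprod, Finset.mul_sum]
  refine Finset.sum_congr rfl fun ν _ => ?_
  rw [hx, hx]
  ring
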